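/- Let $d\ge 1$, and let $\mathcal L=-\Delta+|x|^2$ be the harmonic oscillator on $\mathbb R^d$. For $t>0$ put $$k_t(x,y)=\frac{1}{(2\pi t)^{d/2}}\exp\Big(-\frac{|x-y|^2}{2t}\Big)\exp\big(-\alpha(t)(|x|^2+|y|^2)\big),\qquad \alpha(t)=\frac{\sqrt{1+t^2}-1}{2t};$$ the integral kernel of $e^{-t\mathcal L}$ is $k_{\sinh 2t}$. Let $\mathcal T^*f(x)=\sup_{t>0}e^{-t\mathcal L}|f|(x)$ and $Mf(x)=\sup_{Q\ni x}\frac1{|Q|}\int_Q|f|$, where $Q$ ranges over the half-open cubes with sides parallel to the axes (all cubes below are of this kind). *Grid.* Let $L_0=[-1,1)^d$ and $L_l=[-2^l,2^l)^d\setminus[-2^{l-1},2^{l-1})^d$ for $l\ge1$. The Gaussian grid $\Delta^\gamma_0$ consists of all cubes $2^{-l}(z+[0,1)^d)\subseteq L_l$ with $z\in\mathbb Z^d$, $l\ge0$. It partitions $\mathbb R^d$. Let $R_x$ be the cube of the grid that contains $x$, let $j(R)$ be the index with $R\subseteq L_{j(R)}$, and let $l(R)=2^{-j(R)}$ be the sidelength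 of $R$. For every $R\in\Delta^\gamma_0$ fix a collection $\mathcal N(R)\subseteq\Delta^\gamma_0$ that contains all $R'\in\Delta^\gamma_0$ with $\inf_{x\in R,\,y\in R'}|x-y|<2^{-j(R)}$ and whose union $N(R)$ is a cube of sidelength $4\,l(R)$. Let $\mathcal F(R)=\Delta^\gamma_0\setminus\mathcal N(R)$, and let $M_{loc}f(x)=M(f\chi_{N(R_x)})(x)$. *Far operators.* Let $Q_t(R)$ be the smallest cube that is a union of cubes of $\Delta^\gamma_0$ and contains $\{|y|\le r\}$, where $r=2^{16}d^42^{j(R)}$ if $t\le 2^4d^2$ and $r=2^8t^22^{j(R)}$ if $t\ge2^4d^2$. Let $k_t^+(R,R')$ and $k_t^-(R,R')$ be the supremum and the infimum of $k_t$ over $R\times R'$, and for $x\in R\in\Delta^\gamma_0$ let $$\mathcal M^{\pm}_{far}f(x)=\sup_{t>0}\ \sum_{R'\in\mathcal F(R),\ R'\subseteq Q_t(R)}k^{\pm}_t(R,R')\int_{R'}|f(y)|\,dy .$$ *Classes.* A weight is a locally integrable function $w$ on $\mathbb R^d$ with $w>0$ almost everywhere, and $L^p(w)=L^p(w\,dx)$.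 Let $A_p^{far\pm}$ be the set of weights $w$ for which $\mathcal M^{\pm}_{far}$ is bounded on $L^p(w)$, and let $$A_p^{\pm}=\{w\in A_p^{far\pm}: M_{loc}\text{ is bounded on }L^p(w)\}.$$ Let $A_p^{loc}$ be the set of weights $w$ for which there is a constant $C$ such that $$\Big(\int_Q w^{-\frac1{p-1}}\Big)^{\frac{p-1}p}\Big(\int_Q w\Big)^{\frac1p}\le C|Q|$$ for all $R\in\Delta^\gamma_0$ and all dyadic subcubes $Q$ of $N(R)$, that is, all cubes obtained from $N(R)$ by finitely many (possibly zero) successive divisions into $2^d$ congruent half-open cubes. **Statement.** For every $1<p<\infty$, $$A_p^+\ \subseteq\ \{w\text{ weight on }\mathbb R^d:\ \mathcal T^*\text{ is bounded on }L^p(w)\}\ \subseteq\ A_p^-,$$ and moreover the middle class is contained in $A_p^{far-}\cap A_p^{loc}$. -/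

import Mathlib

open MeasureTheory Set
open scoped ENNReal NNReal

noncomputable section

namespace OscillatorWeights

/-- The Euclidean space `ℝ^d` with its Euclidean norm and Lebesgue measure. -/
abbrev E (d : ℕ) := EuclideanSpace ℝ (Fin d)

variable {d : ℕ}

/-! ### Cubes and the Gaussian grid -/

/-- The half-open cube `[a₁, a₁ + s) × ⋯ × [a_d, a_d + s)`. -/
def cube (a : Fin d → ℝ) (s : ℝ) : Set (E d) :=
  {y | ∀ i, a i ≤ y i ∧ y i < a i + s}

/-- `Q` is a cube of sidelength `s > 0` with sides parallel to the axes. -/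
def IsCubeOfSide (Q : Set (E d)) (s : ℝ) : Prop :=
  0 < s ∧ ∃ a : Fin d → ℝ, Q = cube a s

/-- `Q` is a cube with sides parallel to the axes. -/
def IsCube (Q : Set (E d)) : Prop := ∃ s : ℝ, IsCubeOfSide Q s

/-- `Δ_m`: the cubes `2^{-m} (x + [0,1)^d)` with `x ∈ ℤ^d`. -/
def dyadicCubes (d : ℕ) (m : ℤ) : Set (Set (E d)) :=
  {Q | ∃ x : Fin d → ℤ, Q = cube (fun i => (2 : ℝ) ^ (-m) * x i) ((2 : ℝ) ^ (-m))}

/-- The cube `[-r, r)^d`. -/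
def centredCube (d : ℕ) (r : ℝ) : Set (E d) := cube (fun _ => -r) (2 * r)

/-- The layers `L_0 = [-1,1)^d` and `L_l = [-2^l, 2^l)^d \ [-2^{l-1}, 2^{l-1})^d` for `l ≥ 1`. -/
def layer (d : ℕ) : ℕ → Set (E d)
  | 0 => centredCube d 1
  | l + 1 => centredCube d (2 ^ (l + 1)) \ centredCube d (2 ^ l)

/-- The Gaussian grid `Δ^γ_0`: the cubes of `Δ_l` contained in the layer `L_l`, for all `l ≥ 0`. -/
def gaussianGrid (d : ℕ) : Set (Set (E d)) :=
  {Q | ∃ l : ℕ, Q ∈ dyadicCubes d (l : ℤ) ∧ Q ⊆ layer d l}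

/-- `R_x`, the unique cube of `Δ^γ_0` that contains `x` (the union has exactly one member). -/
def gridCube (x : E d) : Set (E d) := ⋃₀ {R | R ∈ gaussianGrid d ∧ x ∈ R}

/-- `j(R)`, the unique integer with `R ⊆ L_{j(R)}`; every `R ∈ Δ^γ_0` has sidelength
`2^{-j(R)}`. -/
def layerIndex (R : Set (E d)) : ℕ := sInf {l : ℕ | R ⊆ layer d l}

/-- The distance `d(A,B)`, the infimum of `|x - y|` over `x ∈ A` and `y ∈ B`. -/
def setDist (A B : Set (E d)) : ℝ := sInf {r : ℝ | ∃ x ∈ A, ∃ y ∈ B, r = dist x y}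

/-! ### Near and far regions -/

/-- `𝒩` is an admissible choice of near collections: for each `R ∈ Δ^γ_0`, `𝒩 R ⊆ Δ^γ_0` contains
all `R' ∈ Δ^γ_0` with `d(R,R') < 2^{-j(R)}`, and its union is a cube of sidelength `4 l(R)`. -/
def IsNearSystem (𝒩 : Set (E d) → Set (Set (E d))) : Prop :=
  ∀ R ∈ gaussianGrid d,
    𝒩 R ⊆ gaussianGrid d ∧
    (∀ R' ∈ gaussianGrid d, setDist R R' < (2 : ℝ) ^ (-(layerIndex R : ℤ)) → R' ∈ 𝒩 R) ∧
    IsCubeOfSide (⋃₀ 𝒩 R) (4 * (2 : ℝ) ^ (-(layerIndex R : ℤ)))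

/-- The local part `B_loc f(x) = B(f · χ_{N(R_x)})(x)`, where `N(R) = ⋃ 𝒩(R)`. -/
def locPart (𝒩 : Set (E d) → Set (Set (E d))) (B : (E d → ℝ) → E d → ℝ≥0∞)
    (f : E d → ℝ) (x : E d) : ℝ≥0∞ :=
  B (indicator (⋃₀ 𝒩 (gridCube x)) f) x

/-! ### The maximal operators

All operators act on `|f|` and take values in `[0, ∞]`. -/

/-- The (uncentred) Hardy-Littlewood maximal operator over cubes. -/
def hardyLittlewood (f : E d → ℝ) (x : E d) : ℝ≥0∞ :=
  ⨆ (Q : Set (E d)) (_ : IsCube Q ∧ x ∈ Q), (∫⁻ y in Q, ‖f y‖ₑ) / volume Q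

/-- `α(t) = (√(1 + t²) - 1) / (2t)`. -/
def alpha (t : ℝ) : ℝ := (√(1 + t ^ 2) - 1) / (2 * t)

/-- The kernel
`k_t(x,y) = (2πt)^{-d/2} exp(-|x-y|²/(2t)) exp(-α(t)(|x|² + |y|²))`. -/
def oscKernel (t : ℝ) (x y : E d) : ℝ :=
  1 / (2 * Real.pi * t) ^ ((d : ℝ) / 2) * Real.exp (-(‖x - y‖ ^ 2) / (2 * t)) *
    Real.exp (-(alpha t) * (‖x‖ ^ 2 + ‖y‖ ^ 2))

/-- `e^{-tℒ}|f|(x)` for the harmonic oscillator `ℒ = -Δ + |x|²`: by Mehler's formula the integral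
kernel of `e^{-tℒ}` is `k_{sinh 2t}`. -/
def oscSemigroup (t : ℝ) (f : E d → ℝ) (x : E d) : ℝ≥0∞ :=
  ∫⁻ y, ENNReal.ofReal (oscKernel (Real.sinh (2 * t)) x y) * ‖f y‖ₑ

/-- The heat maximal operator `𝒯* f(x) = sup_{t > 0} e^{-tℒ}|f|(x)`. -/
def oscMaximal (f : E d → ℝ) (x : E d) : ℝ≥0∞ :=
  ⨆ (t : ℝ) (_ : 0 < t), oscSemigroup t f x

/-- `k_t^+(A,B)`, the supremum of `k_t` over `A × B`. -/
def kernelSup (t : ℝ) (A B : Set (E d)) : ℝ≥0∞ :=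
  ⨆ x ∈ A, ⨆ y ∈ B, ENNReal.ofReal (oscKernel t x y)

/-- `k_t^-(A,B)`, the infimum of `k_t` over `A × B`. -/
def kernelInf (t : ℝ) (A B : Set (E d)) : ℝ≥0∞ :=
  ⨅ x ∈ A, ⨅ y ∈ B, ENNReal.ofReal (oscKernel t x y)

/-- The smallest cube that contains the closed ball of radius `r` about the origin and is a union of
cubes of `Δ^γ_0`. For `d ≥ 1` there is a least such cube with respect to inclusion, so it is the
intersection of all of them. -/
def smallestCube (d : ℕ) (r : ℝ) : Set (E d) :=
  ⋂₀ {Q | IsCube Q ∧ {y : E d | ‖y‖ ≤ r} ⊆ Q ∧ ∃ 𝒞 ⊆ gaussianGrid d, Q = ⋃₀ 𝒞}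

/-- The cube `Q_t(R)`, built from the radius `2^16 d^4 2^{j(R)}` if `t ≤ 2^4 d²` and from
`2^8 t² 2^{j(R)}` if `t ≥ 2^4 d²`. -/
def farCube (t : ℝ) (R : Set (E d)) : Set (E d) :=
  smallestCube d
    (if t ≤ 2 ^ 4 * (d : ℝ) ^ 2 then 2 ^ 16 * (d : ℝ) ^ 4 * 2 ^ layerIndex R
      else 2 ^ 8 * t ^ 2 * 2 ^ layerIndex R)

/-- The cubes `R' ∈ ℱ(R) = Δ^γ_0 \ 𝒩(R)` with `R' ⊆ Q_t(R)`. -/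
def farFamily (𝒩 : Set (E d) → Set (Set (E d))) (t : ℝ) (R : Set (E d)) : Set (Set (E d)) :=
  {R' | R' ∈ gaussianGrid d \ 𝒩 R ∧ R' ⊆ farCube t R}

/-- The operator `ℳ^+_far`. -/
def farMaximalPlus (𝒩 : Set (E d) → Set (Set (E d))) (f : E d → ℝ) (x : E d) : ℝ≥0∞ :=
  ⨆ (t : ℝ) (_ : 0 < t), ∑' R' : farFamily 𝒩 t (gridCube x),
    kernelSup t (gridCube x) R' * ∫⁻ y in (R' : Set (E d)), ‖f y‖ₑ

/-- The operator `ℳ^-_far`. -/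
def farMaximalMinus (𝒩 : Set (E d) → Set (Set (E d))) (f : E d → ℝ) (x : E d) : ℝ≥0∞ :=
  ⨆ (t : ℝ) (_ : 0 < t), ∑' R' : farFamily 𝒩 t (gridCube x),
    kernelInf t (gridCube x) R' * ∫⁻ y in (R' : Set (E d)), ‖f y‖ₑ

/-! ### Weights and weight classes -/

/-- A weight: a locally integrable function that is positive almost everywhere. -/
def IsWeight (w : E d → ℝ) : Prop :=
  LocallyIntegrable w ∧ ∀ᵐ x, 0 < w x

/-- The measure `w(x) dx`. -/
def weightMeasure (w : E d → ℝ) : Measure (E d) :=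
  volume.withDensity fun x => ENNReal.ofReal (w x)

/-- `‖B‖_{L^p(w) → L^p(w)} < ∞`. -/
def BoundedOnLp (p : ℝ) (w : E d → ℝ) (B : (E d → ℝ) → E d → ℝ≥0∞) : Prop :=
  ∃ C : ℝ≥0, ∀ f : E d → ℝ, MemLp f (ENNReal.ofReal p) (weightMeasure w) →
    eLpNorm (B f) (ENNReal.ofReal p) (weightMeasure w) ≤
      C * eLpNorm f (ENNReal.ofReal p) (weightMeasure w)

/-- The weights `w` for which `𝒯*` is bounded on `L^p(w)`. -/
def oscClass (d : ℕ) (p : ℝ) : Set (E d → ℝ) :=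
  {w | IsWeight w ∧ BoundedOnLp p w oscMaximal}

/-- `A_p^{far+}`. -/
def ApFarPlus (𝒩 : Set (E d) → Set (Set (E d))) (p : ℝ) : Set (E d → ℝ) :=
  {w | IsWeight w ∧ BoundedOnLp p w (farMaximalPlus 𝒩)}

/-- `A_p^{far-}`. -/
def ApFarMinus (𝒩 : Set (E d) → Set (Set (E d))) (p : ℝ) : Set (E d → ℝ) :=
  {w | IsWeight w ∧ BoundedOnLp p w (farMaximalMinus 𝒩)}

/-- The weights for which `M_loc` is bounded on `L^p(w)`. -/
def locClass (𝒩 : Set (E d) → Set (Set (E d))) (p : ℝ) : Set (E d → ℝ) :=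
  {w | IsWeight w ∧ BoundedOnLp p w (locPart 𝒩 hardyLittlewood)}

/-- `A_p^+`: both `ℳ^+_far` and `M_loc` are bounded on `L^p(w)`. -/
def ApPlus (𝒩 : Set (E d) → Set (Set (E d))) (p : ℝ) : Set (E d → ℝ) :=
  ApFarPlus 𝒩 p ∩ locClass 𝒩 p

/-- `A_p^-`: both `ℳ^-_far` and `M_loc` are bounded on `L^p(w)`. -/
def ApMinus (𝒩 : Set (E d) → Set (Set (E d))) (p : ℝ) : Set (E d → ℝ) :=
  ApFarMinus 𝒩 p ∩ locClass 𝒩 p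

/-- `Q` is obtained from the cube `Q₀` by finitely many (possibly zero) successive divisions into
`2^d` congruent half-open cubes. -/
def IsDyadicSubcube (Q Q₀ : Set (E d)) : Prop :=
  ∃ (a : Fin d → ℝ) (s : ℝ), 0 < s ∧ Q₀ = cube a s ∧
    ∃ (n : ℕ) (m : Fin d → ℕ), (∀ i, m i < 2 ^ n) ∧
      Q = cube (fun i => a i + m i * (s / 2 ^ n)) (s / 2 ^ n)

/-- The dyadic local class `A_p^loc`: there is `C` with
`(∫_Q w^{-1/(p-1)})^{(p-1)/p} (∫_Q w)^{1/p} ≤ C |Q|` for every `R ∈ Δ^γ_0` and every dyadic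
subcube `Q` of `N(R)`. -/
def ApLoc (𝒩 : Set (E d) → Set (Set (E d))) (p : ℝ) : Set (E d → ℝ) :=
  {w | IsWeight w ∧ ∃ C : ℝ≥0, ∀ R ∈ gaussianGrid d, ∀ Q, IsDyadicSubcube Q (⋃₀ 𝒩 R) →
    (∫⁻ y in Q, ENNReal.ofReal (w y) ^ (-(1 / (p - 1)))) ^ ((p - 1) / p) *
      (∫⁻ y in Q, ENNReal.ofReal (w y)) ^ (1 / p) ≤ C * volume Q}

end OscillatorWeights

end

open OscillatorWeights

namespace OscillatorWeights

variable {d : ℕ}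

/-! ### Cubes -/

/-! Since `sinh (2t)` runs through all of `(0, ∞)`, `𝒯*` is the supremum over `t > 0` of the
integrals against `k_t`. All inclusions follow from pointwise comparisons, except for `A_p^loc`,
which needs a test function.

Upper bound: `𝒯* f ≤ c M_loc f + 2 d! ℳ^+_far f` (`oscMaximal_le`). On `N(R_x)` the kernel is at
most a Gaussian, hence a summable combination of normalised indicators of cubes around `x`
(`oscKernel_le_tsum`). Off `N(R_x)` but inside `Q_t(R_x)`, the integral is at most the sum defining
`ℳ^+_far`. The remaining `y` are so far out that `k_t(x,y)` is at most `d!/T` times `k_T(x,y)` for a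
later time `T` with `y ∈ Q_T(R_x)` (`oscKernel_le_of_far`). The exponent `-√(1+t²)/(2t) (|x|²+|y|²)
+ x·y/t` improves with `t` when `|y|` is large compared with `t|x|` and `t²`. Taking `T` from a
doubling sequence gives a geometric series (`exists_farTime`).

Lower bounds: `ℳ^-_far f ≤ 𝒯* f` because grid cubes are disjoint. Near a cube `R` of layer `j` all
points have size `O(2^j)`, while the relevant scales satisfy `s 2^j ≤ 4`; so the factor with `α(s²)`
is harmless and `k_{s²} ≥ c s^{-d}` at distance about `s` (`nearConst_div_le_oscKernel`). Thus `𝒯*`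
dominates local averages, which gives `M_loc f ≤ C 𝒯* f`. Testing `𝒯*` on a truncation of
`w^{-1/(p-1)} χ_Q` gives the `A_p^loc` condition. -/

lemma measurableSet_cube (a : Fin d → ℝ) (s : ℝ) : MeasurableSet (cube a s) := by
  have h : cube a s = ⋂ i, {y : E d | a i ≤ y i ∧ y i < a i + s} := by
    ext y; simp [cube]
  rw [h]
  refine MeasurableSet.iInter fun i => ?_
  have hm : Measurable fun y : E d => y i := by fun_prop
  exact (measurableSet_le measurable_const hm).inter (measurableSet_lt hm measurable_const)

lemma volume_cube (a : Fin d → ℝ) (s : ℝ) : volume (cube a s) = ENNReal.ofReal s ^ d := by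
  have h : cube a s = (WithLp.ofLp : E d → Fin d → ℝ) ⁻¹'
      (Set.pi univ fun i => Ico (a i) (a i + s)) := by
    ext y; simp [cube]
  have hm : MeasurableSet (Set.pi univ fun i => Ico (a i) (a i + s)) :=
    MeasurableSet.univ_pi fun _ => measurableSet_Ico
  rw [h, (PiLp.volume_preserving_ofLp (Fin d)).measure_preimage hm.nullMeasurableSet,
    Real.volume_pi_Ico]
  simp

lemma abs_sub_le_of_mem_cube {a : Fin d → ℝ} {s : ℝ} {x y : E d} (hx : x ∈ cube a s)
    (hy : y ∈ cube a s) (i : Fin d) : |x i - y i| ≤ s := by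
  have h₁ := hx i
  have h₂ := hy i
  rw [abs_le]
  constructor <;> linarith

lemma corner_mem_cube (a : Fin d → ℝ) {s : ℝ} (hs : 0 < s) : WithLp.toLp 2 a ∈ cube a s :=
  fun i => ⟨le_rfl, by simpa using hs⟩

/-- The volume determines the side once `d ≥ 1`. This reconciles the side of `N(R)` in
`IsDyadicSubcube` with the one in `IsNearSystem`. -/
lemma side_eq_of_cube_eq (hd : 1 ≤ d) {a b : Fin d → ℝ} {s r : ℝ} (hs : 0 < s) (hr : 0 < r)
    (h : cube a s = cube b r) : s = r := by
  have hv := congrArg volume h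
  rw [volume_cube, volume_cube, ← ENNReal.ofReal_pow hs.le, ← ENNReal.ofReal_pow hr.le,
    ENNReal.ofReal_eq_ofReal_iff (by positivity) (by positivity)] at hv
  exact (pow_left_inj₀ hs.le hr.le (by omega)).1 hv

lemma cube_subset_of_isDyadicSubcube {Q Q₀ : Set (E d)} (h : IsDyadicSubcube Q Q₀) : Q ⊆ Q₀ := by
  obtain ⟨a, s, hs, rfl, n, m, hm, rfl⟩ := h
  intro y hy i
  have h₁ := hy i
  have h2 : (0 : ℝ) < 2 ^ n := by positivity
  have h3 : ((m i : ℝ) + 1) ≤ 2 ^ n := by exact_mod_cast hm i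
  have h4 : 0 ≤ (m i : ℝ) * (s / 2 ^ n) := by positivity
  have h5 : ((m i : ℝ) + 1) * (s / 2 ^ n) ≤ s := by
    calc _ ≤ (2 : ℝ) ^ n * (s / 2 ^ n) := by gcongr
      _ = s := by field_simp
  constructor <;> linarith

/-! ### The Gaussian grid -/

lemma mem_centredCube {r : ℝ} {x : E d} : x ∈ centredCube d r ↔ ∀ i, -r ≤ x i ∧ x i < r := by
  refine forall_congr' fun i => ?_
  have : -r + 2 * r = r := by ring
  rw [this]

lemma centredCube_mono {r s : ℝ} (h : r ≤ s) : centredCube d r ⊆ centredCube d s := by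
  intro x hx
  rw [mem_centredCube] at *
  exact fun i => ⟨by linarith [(hx i).1], by linarith [(hx i).2]⟩

/-- The layer of a point is the first `k` with `x ∈ [-2^k, 2^k)^d`; existence and uniqueness of the
layer then come from minimality. -/
lemma mem_layer {l : ℕ} {x : E d} :
    x ∈ layer d l ↔ x ∈ centredCube d (2 ^ l) ∧ ∀ k < l, x ∉ centredCube d (2 ^ k) := by
  cases l with
  | zero => simp [layer]
  | succ l =>
    refine and_congr_right fun _ => ⟨fun h k hk hx => h ?_, fun h => h l (by omega)⟩
    exact centredCube_mono (pow_le_pow_right₀ one_le_two (by omega)) hx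

lemma layer_eq {l k : ℕ} {x : E d} (hl : x ∈ layer d l) (hk : x ∈ layer d k) : l = k := by
  rw [mem_layer] at hl hk
  by_contra h
  rcases lt_or_gt_of_ne h with h | h
  · exact hk.2 l h hl.1
  · exact hl.2 k h hk.1

lemma exists_mem_layer (x : E d) : ∃ l, x ∈ layer d l := by
  classical
  have h : ∃ l : ℕ, x ∈ centredCube d (2 ^ l) := by
    obtain ⟨n, hn⟩ := pow_unbounded_of_one_lt ‖x‖ (one_lt_two (α := ℝ))
    refine ⟨n, mem_centredCube.2 fun i => ?_⟩
    have h₁ : |x i| ≤ ‖x‖ := PiLp.norm_apply_le x i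
    have h₂ := abs_lt.1 (h₁.trans_lt hn)
    exact ⟨h₂.1.le, h₂.2⟩
  exact ⟨Nat.find h, mem_layer.2 ⟨Nat.find_spec h, fun k hk => Nat.find_min h hk⟩⟩

lemma mem_dyadic_iff {l : ℕ} {m : Fin d → ℤ} {x : E d} :
    x ∈ cube (fun i => (2 : ℝ) ^ (-(l : ℤ)) * m i) ((2 : ℝ) ^ (-(l : ℤ))) ↔
      ∀ i, ⌊(2 : ℝ) ^ l * x i⌋ = m i := by
  refine forall_congr' fun i => ?_
  rw [Int.floor_eq_iff, zpow_neg, zpow_natCast]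
  have h : (0 : ℝ) < 2 ^ l := by positivity
  refine and_congr ?_ ?_
  · rw [inv_mul_le_iff₀ h]
  · rw [← mul_add_one, lt_inv_mul_iff₀ h]

/-- The faces of `[-2^k, 2^k)^d` lie at integer multiples of `2^{-l}`, so no dyadic cube of side
`2^{-l}` crosses them. Hence the dyadic cube of side `2^{-l}` around a point of `L_l` stays in
`L_l`, and the grid covers the space. -/
lemma mem_centredCube_iff_of_floor_eq {l : ℕ} {x y : E d}
    (h : ∀ i, ⌊(2 : ℝ) ^ l * x i⌋ = ⌊(2 : ℝ) ^ l * y i⌋) (k : ℕ) :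
    x ∈ centredCube d (2 ^ k) ↔ y ∈ centredCube d (2 ^ k) := by
  have key : ∀ z : E d, z ∈ centredCube d (2 ^ k) ↔
      ∀ i, -(2 ^ l * 2 ^ k : ℤ) ≤ ⌊(2 : ℝ) ^ l * z i⌋ ∧
        ⌊(2 : ℝ) ^ l * z i⌋ < (2 ^ l * 2 ^ k : ℤ) := by
    intro z
    rw [mem_centredCube]
    refine forall_congr' fun i => ?_
    rw [Int.le_floor, Int.floor_lt]
    push_cast
    have h : (0 : ℝ) < 2 ^ l := by positivity
    rw [← mul_neg, mul_le_mul_iff_right₀ h, mul_lt_mul_iff_right₀ h]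
  rw [key, key]
  simp only [h]

lemma countable_gaussianGrid : (gaussianGrid d).Countable := by
  have : gaussianGrid d ⊆ range fun q : ℕ × (Fin d → ℤ) =>
      (cube (fun i => (2 : ℝ) ^ (-(q.1 : ℤ)) * q.2 i) ((2 : ℝ) ^ (-(q.1 : ℤ))) : Set (E d)) := by
    rintro Q ⟨l, ⟨m, rfl⟩, -⟩
    exact ⟨(l, m), rfl⟩
  exact (countable_range _).mono this

lemma measurableSet_of_mem_gaussianGrid {R : Set (E d)} (hR : R ∈ gaussianGrid d) :
    MeasurableSet R := by
  obtain ⟨l, ⟨m, rfl⟩, -⟩ := hR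
  exact measurableSet_cube _ _

lemma eq_of_mem_gaussianGrid {R S : Set (E d)} (hR : R ∈ gaussianGrid d) (hS : S ∈ gaussianGrid d)
    {x : E d} (hxR : x ∈ R) (hxS : x ∈ S) : R = S := by
  obtain ⟨l, ⟨m, rfl⟩, hl⟩ := hR
  obtain ⟨k, ⟨n, rfl⟩, hk⟩ := hS
  obtain rfl := layer_eq (hl hxR) (hk hxS)
  have : m = n := by
    funext i
    rw [← mem_dyadic_iff.1 hxR i, ← mem_dyadic_iff.1 hxS i]
  rw [this]

lemma exists_mem_gaussianGrid (x : E d) : ∃ R ∈ gaussianGrid d, x ∈ R := by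
  obtain ⟨l, hl⟩ := exists_mem_layer x
  refine ⟨_, ⟨l, ⟨fun i => ⌊(2 : ℝ) ^ l * x i⌋, rfl⟩, fun y hy => ?_⟩,
    mem_dyadic_iff.2 fun i => rfl⟩
  have h := mem_centredCube_iff_of_floor_eq (mem_dyadic_iff.1 hy)
  rw [mem_layer] at hl ⊢
  simpa only [h] using hl

lemma gridCube_eq {R : Set (E d)} (hR : R ∈ gaussianGrid d) {x : E d} (hx : x ∈ R) :
    gridCube x = R := by
  have : {S | S ∈ gaussianGrid d ∧ x ∈ S} = {R} := by
    ext S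
    exact ⟨fun h => eq_of_mem_gaussianGrid h.1 hR h.2 hx, by rintro rfl; exact ⟨hR, hx⟩⟩
  rw [gridCube, this, sUnion_singleton]

lemma gridCube_mem (x : E d) : gridCube x ∈ gaussianGrid d := by
  obtain ⟨R, hR, hx⟩ := exists_mem_gaussianGrid x
  rwa [gridCube_eq hR hx]

lemma mem_gridCube (x : E d) : x ∈ gridCube x := by
  obtain ⟨R, hR, hx⟩ := exists_mem_gaussianGrid x
  rwa [gridCube_eq hR hx]

/-- Such a set is a union of grid cubes, of which there are countably many. -/
lemma measurableSet_of_gridCube_subset {A : Set (E d)} (h : ∀ y ∈ A, gridCube y ⊆ A) :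
    MeasurableSet A := by
  have hA : A = ⋃₀ {S | S ∈ gaussianGrid d ∧ S ⊆ A} := by
    refine Subset.antisymm (fun y hy => ?_) (sUnion_subset fun S hS => hS.2)
    exact ⟨gridCube y, ⟨gridCube_mem y, h y hy⟩, mem_gridCube y⟩
  rw [hA]
  exact MeasurableSet.sUnion (countable_gaussianGrid.mono fun S hS => hS.1)
    fun S hS => measurableSet_of_mem_gaussianGrid hS.1

lemma nonempty_of_mem_gaussianGrid {R : Set (E d)} (hR : R ∈ gaussianGrid d) : R.Nonempty := by
  obtain ⟨l, ⟨m, rfl⟩, -⟩ := hR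
  exact ⟨_, corner_mem_cube _ (by positivity)⟩

lemma subset_layer_layerIndex {R : Set (E d)} (hR : R ∈ gaussianGrid d) :
    R ⊆ layer d (layerIndex R) := by
  obtain ⟨l, -, hl⟩ := hR
  exact Nat.sInf_mem (s := {l : ℕ | R ⊆ layer d l}) ⟨l, hl⟩

lemma abs_le_two_pow_layerIndex {R : Set (E d)} (hR : R ∈ gaussianGrid d) {x : E d} (hx : x ∈ R)
    (i : Fin d) : |x i| ≤ 2 ^ layerIndex R := by
  have h := mem_centredCube.1 (mem_layer.1 (subset_layer_layerIndex hR hx)).1 i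
  exact abs_le.2 ⟨h.1, h.2.le⟩

lemma norm_sq_le_of_abs_le {x : E d} {r : ℝ} (h : ∀ i, |x i| ≤ r) :
    ‖x‖ ^ 2 ≤ d * r ^ 2 := by
  rw [EuclideanSpace.norm_sq_eq]
  calc ∑ i, ‖x i‖ ^ 2 ≤ ∑ _i : Fin d, r ^ 2 := by
        gcongr with i
        exact h i
    _ = d * r ^ 2 := by simp

/-! ### Near and far regions -/

lemma subset_near {𝒩 : Set (E d) → Set (Set (E d))} (h𝒩 : IsNearSystem 𝒩) {R : Set (E d)}
    (hR : R ∈ gaussianGrid d) : R ⊆ ⋃₀ 𝒩 R := by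
  refine subset_sUnion_of_mem ((h𝒩 R hR).2.1 R hR ?_)
  obtain ⟨x, hx⟩ := nonempty_of_mem_gaussianGrid hR
  have h : setDist R R ≤ 0 :=
    csInf_le ⟨0, by rintro r ⟨x, -, y, -, rfl⟩; exact dist_nonneg⟩ ⟨x, hx, x, hx, by simp⟩
  exact h.trans_lt (by positivity)

lemma measurableSet_near {𝒩 : Set (E d) → Set (Set (E d))} (h𝒩 : IsNearSystem 𝒩) {R : Set (E d)}
    (hR : R ∈ gaussianGrid d) : MeasurableSet (⋃₀ 𝒩 R) := by
  obtain ⟨-, a, ha⟩ := (h𝒩 R hR).2.2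
  rw [ha]
  exact measurableSet_cube _ _

lemma abs_sub_le_of_mem_near {𝒩 : Set (E d) → Set (Set (E d))} (h𝒩 : IsNearSystem 𝒩)
    {R : Set (E d)} (hR : R ∈ gaussianGrid d) {x y : E d} (hx : x ∈ ⋃₀ 𝒩 R) (hy : y ∈ ⋃₀ 𝒩 R)
    (i : Fin d) : |x i - y i| ≤ 4 * (2 : ℝ) ^ (-(layerIndex R : ℤ)) := by
  obtain ⟨-, a, ha⟩ := (h𝒩 R hR).2.2
  rw [ha] at hx hy
  exact abs_sub_le_of_mem_cube hx hy i

lemma abs_le_of_mem_near {𝒩 : Set (E d) → Set (Set (E d))} (h𝒩 : IsNearSystem 𝒩)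
    {R : Set (E d)} (hR : R ∈ gaussianGrid d) {x : E d} (hx : x ∈ ⋃₀ 𝒩 R) (i : Fin d) :
    |x i| ≤ 5 * 2 ^ layerIndex R := by
  obtain ⟨y, hy⟩ := nonempty_of_mem_gaussianGrid hR
  have h₁ := abs_sub_le_of_mem_near h𝒩 hR hx (subset_near h𝒩 hR hy) i
  have h₂ := abs_le_two_pow_layerIndex hR hy i
  have h₃ : (1 : ℝ) ≤ 2 ^ layerIndex R := one_le_pow₀ one_le_two
  have h₄ : (2 : ℝ) ^ (-(layerIndex R : ℤ)) ≤ 1 := by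
    rw [zpow_neg, zpow_natCast]
    exact inv_le_one_of_one_le₀ h₃
  have h₅ : |x i| ≤ |x i - y i| + |y i| := by
    simpa using abs_add_le (x i - y i) (y i)
  linarith

lemma subset_smallestCube (r : ℝ) : {y : E d | ‖y‖ ≤ r} ⊆ smallestCube d r :=
  subset_sInter fun _ h => h.2.1

/-- An intersection of unions of grid cubes is again such a union. Together with containing the
ball, this is all that the proof needs about `smallestCube`. -/
lemma gridCube_subset_smallestCube {r : ℝ} {y : E d} (hy : y ∈ smallestCube d r) :
    gridCube y ⊆ smallestCube d r := by
  refine subset_sInter fun Q hQ => ?_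
  have hyQ : y ∈ Q := hy Q hQ
  obtain ⟨-, -, 𝒞, h𝒞, rfl⟩ := hQ
  obtain ⟨S, hS, hyS⟩ := hyQ
  rw [gridCube_eq (h𝒞 hS) hyS]
  exact subset_sUnion_of_mem hS

lemma gridCube_mem_farFamily {𝒩 : Set (E d) → Set (Set (E d))} {t : ℝ} {R : Set (E d)} {y : E d}
    (hN : y ∉ ⋃₀ 𝒩 R) (hy : y ∈ farCube t R) : gridCube y ∈ farFamily 𝒩 t R :=
  ⟨⟨gridCube_mem y, fun h => hN ⟨_, h, mem_gridCube y⟩⟩, gridCube_subset_smallestCube hy⟩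

/-- The two radii in `Q_t(R)` are one formula, because `2^8 (2^4 d²)² = 2^16 d^4`. -/
lemma mem_farCube_of_norm_le {t : ℝ} {R : Set (E d)} {y : E d}
    (hy : ‖y‖ ≤ 2 ^ 8 * max t (2 ^ 4 * (d : ℝ) ^ 2) ^ 2 * 2 ^ layerIndex R) :
    y ∈ farCube t R := by
  apply subset_smallestCube
  rw [mem_ofPred_eq]
  split_ifs with h
  · rw [max_eq_right h] at hy
    exact hy.trans_eq (by ring)
  · rwa [max_eq_left (not_le.1 h).le] at hy

lemma countable_farFamily (𝒩 : Set (E d) → Set (Set (E d))) (t : ℝ) (R : Set (E d)) :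
    (farFamily 𝒩 t R).Countable :=
  countable_gaussianGrid.mono fun _ h => h.1.1

/-! ### Kernel estimates -/

lemma measurable_oscKernel (t : ℝ) (x : E d) : Measurable (oscKernel t x) := by
  unfold oscKernel
  fun_prop

lemma alpha_nonneg {t : ℝ} (ht : 0 < t) : 0 ≤ alpha t := by
  have : 1 ≤ √(1 + t ^ 2) := Real.one_le_sqrt.2 (by nlinarith)
  exact div_nonneg (by linarith) (by linarith)

lemma alpha_le {t : ℝ} (ht : 0 < t) : alpha t ≤ t / 4 := by
  have : √(1 + t ^ 2) ≤ 1 + t ^ 2 / 2 :=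
    Real.sqrt_le_iff.2 ⟨by positivity, by nlinarith [sq_nonneg (t ^ 2)]⟩
  rw [alpha, div_le_iff₀ (by positivity)]
  nlinarith

lemma oscKernel_eq {t : ℝ} (ht : 0 < t) (x y : E d) :
    oscKernel t x y = 1 / (2 * Real.pi * t) ^ ((d : ℝ) / 2) *
      Real.exp (-(√(1 + t ^ 2) / (2 * t) * (‖x‖ ^ 2 + ‖y‖ ^ 2)) + inner ℝ x y / t) := by
  rw [oscKernel, mul_assoc, ← Real.exp_add, norm_sub_sq_real, alpha]
  congr 2
  field_simp
  ring

/-- Both quotients exceed `1/2`: the first by at least `1/(2s(2s+1)) ≥ 1/(3st)`, the second by at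
most `1/(4t²) ≤ 1/(8st)`. -/
lemma le_sqrt_div_sub_sqrt_div {s t : ℝ} (hs : 0 < s) (hst : 2 * s ≤ t) (ht : 2 ≤ t) :
    1 / (8 * s * t) ≤ √(1 + s ^ 2) / (2 * s) - √(1 + t ^ 2) / (2 * t) := by
  have ht0 : 0 < t := by linarith
  have h₁ : s + 1 / (2 * s + 1) ≤ √(1 + s ^ 2) := by
    apply Real.le_sqrt_of_sq_le
    have h : (1 : ℝ) + s ^ 2 - (s + 1 / (2 * s + 1)) ^ 2 = 2 * s / (2 * s + 1) ^ 2 := by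
      field_simp
      ring
    have : 0 ≤ 2 * s / (2 * s + 1) ^ 2 := by positivity
    linarith
  have h₂ : √(1 + t ^ 2) ≤ t + 1 / (2 * t) := by
    refine Real.sqrt_le_iff.2 ⟨by positivity, ?_⟩
    have h : (t + 1 / (2 * t)) ^ 2 = 1 + t ^ 2 + (1 / (2 * t)) ^ 2 := by
      field_simp
      ring
    rw [h]
    linarith [sq_nonneg (1 / (2 * t))]
  have h₃ : 1 / 2 + 1 / (2 * s * (2 * s + 1)) ≤ √(1 + s ^ 2) / (2 * s) := by
    rw [le_div_iff₀ (by positivity)]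
    refine le_trans (le_of_eq ?_) h₁
    field_simp
  have h₄ : √(1 + t ^ 2) / (2 * t) ≤ 1 / 2 + 1 / (4 * t * t) := by
    rw [div_le_iff₀ (by positivity)]
    refine h₂.trans (le_of_eq ?_)
    field_simp
    ring
  have h₅ : 1 / (3 * s * t) ≤ 1 / (2 * s * (2 * s + 1)) :=
    one_div_le_one_div_of_le (by positivity) (by nlinarith)
  have h₆ : 1 / (4 * t * t) ≤ 1 / (8 * s * t) :=
    one_div_le_one_div_of_le (by positivity) (by nlinarith)
  have h₇ : 1 / (3 * s * t) = 1 / (8 * s * t) + 1 / (8 * s * t) + 1 / (12 * s * t) := by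
    field_simp
    norm_num
  have h₈ : 0 < 1 / (12 * s * t) := by positivity
  linarith

/-- Moving from `s` to `t` gains `|y|²/(8st)` in the quadratic term. Half of it absorbs the change
of the cross term, at most `|x||y|/s ≤ |y|²/(16st)`; the other half is at least `t²/s`. -/
lemma exponent_le_of_far {s t : ℝ} {x y : E d} (hs : 0 < s) (hst : 2 * s ≤ t) (ht : 2 ≤ t)
    (hx : 16 * t * ‖x‖ ≤ ‖y‖) (hy : 64 * t ^ 2 ≤ ‖y‖) :
    -(√(1 + s ^ 2) / (2 * s) * (‖x‖ ^ 2 + ‖y‖ ^ 2)) + inner ℝ x y / s ≤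
      -(t ^ 2 / s) +
        (-(√(1 + t ^ 2) / (2 * t) * (‖x‖ ^ 2 + ‖y‖ ^ 2)) + inner ℝ x y / t) := by
  have ht0 : 0 < t := by linarith
  have h₁ : 1 / (8 * s * t) * ‖y‖ ^ 2 ≤
      (√(1 + s ^ 2) / (2 * s) - √(1 + t ^ 2) / (2 * t)) * (‖x‖ ^ 2 + ‖y‖ ^ 2) := by
    have h := le_sqrt_div_sub_sqrt_div hs hst ht
    have h₀ : 0 < 1 / (8 * s * t) := by positivity
    exact mul_le_mul h (by nlinarith [sq_nonneg ‖x‖]) (by positivity) (h₀.le.trans h)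
  have h₂ : inner ℝ x y * (1 / s - 1 / t) ≤ 1 / (16 * s * t) * ‖y‖ ^ 2 := by
    have h₃ : 1 / t ≤ 1 / s := one_div_le_one_div_of_le hs (by linarith)
    have h₄ : 0 < 1 / t := by positivity
    calc inner ℝ x y * (1 / s - 1 / t) ≤ (‖x‖ * ‖y‖) * (1 / s) :=
          mul_le_mul (real_inner_le_norm x y) (by linarith) (by linarith) (by positivity)
      _ = 1 / (16 * s * t) * ((16 * t * ‖x‖) * ‖y‖) := by
          field_simp
      _ ≤ 1 / (16 * s * t) * (‖y‖ * ‖y‖) := by gcongr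
      _ = _ := by ring
  have h₅ : t ^ 2 / s ≤ 1 / (16 * s * t) * ‖y‖ ^ 2 := by
    calc t ^ 2 / s ≤ t ^ 2 / s * (256 * t) := le_mul_of_one_le_right (by positivity) (by linarith)
      _ = 1 / (16 * s * t) * (64 * t ^ 2) ^ 2 := by
          field_simp
          norm_num
      _ ≤ _ := by gcongr
  have h₆ : 1 / (8 * s * t) * ‖y‖ ^ 2 = 2 * (1 / (16 * s * t) * ‖y‖ ^ 2) := by
    field_simp
    ring
  have h₇ : inner ℝ x y * (1 / s - 1 / t) = inner ℝ x y / s - inner ℝ x y / t := by ring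
  linarith

/-- The gain `exp(-t²/s)` beats the ratio of the prefactors: `(t/s)^d = (t²/s)^d / t^d ≤ d!
exp(t²/s) / t^d`, and `t^d ≥ t`. The remaining factor `1/t` makes the later sum over times converge.
-/
lemma oscKernel_le_of_far (hd : 1 ≤ d) {s t : ℝ} {x y : E d} (hs : 0 < s) (hst : 2 * s ≤ t)
    (ht : 2 ≤ t) (hx : 16 * t * ‖x‖ ≤ ‖y‖) (hy : 64 * t ^ 2 ≤ ‖y‖) :
    oscKernel s x y ≤ d.factorial / t * oscKernel t x y := by
  have ht0 : 0 < t := by linarith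
  have h₁ : (t / s) ^ ((d : ℝ) / 2) ≤ (t / s) ^ d := by
    rw [← Real.rpow_natCast]
    refine Real.rpow_le_rpow_of_exponent_le ?_ (half_le_self (by positivity))
    rw [one_le_div hs]
    linarith
  have h₂ : (t / s) ^ d ≤ d.factorial / t * Real.exp (t ^ 2 / s) := by
    have h := Real.pow_div_factorial_le_exp (t ^ 2 / s) (by positivity) d
    rw [div_le_iff₀ (by positivity)] at h
    calc (t / s) ^ d = (t ^ 2 / s) ^ d / t ^ d := by
          rw [← div_pow]
          congr 1
          field_simp
      _ ≤ (Real.exp (t ^ 2 / s) * d.factorial) / t ^ d := by gcongr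
      _ ≤ (Real.exp (t ^ 2 / s) * d.factorial) / t := by
          gcongr
          exact le_self_pow₀ (by linarith) (by omega)
      _ = _ := by ring
  have h₃ : 1 / (2 * Real.pi * s) ^ ((d : ℝ) / 2) =
      (t / s) ^ ((d : ℝ) / 2) * (1 / (2 * Real.pi * t) ^ ((d : ℝ) / 2)) := by
    have hpi := Real.pi_pos
    rw [Real.div_rpow ht0.le hs.le, Real.mul_rpow (by positivity) hs.le,
      Real.mul_rpow (by positivity) ht0.le]
    field_simp
  rw [oscKernel_eq hs, oscKernel_eq ht0, h₃]
  set A := 1 / (2 * Real.pi * t) ^ ((d : ℝ) / 2) with hA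
  have hA0 : 0 ≤ A := by have := Real.pi_pos; positivity
  calc _ ≤ (d.factorial / t * Real.exp (t ^ 2 / s)) * A * Real.exp (-(t ^ 2 / s) +
        (-(√(1 + t ^ 2) / (2 * t) * (‖x‖ ^ 2 + ‖y‖ ^ 2)) + inner ℝ x y / t)) := by
        refine mul_le_mul (mul_le_mul_of_nonneg_right (h₁.trans h₂) hA0)
          (Real.exp_le_exp.2 ?_) (by positivity) (by positivity)
        exact exponent_le_of_far hs hst ht hx hy
    _ = _ := by
        rw [Real.exp_add, Real.exp_neg]
        field_simp

/-- A lower bound for `s ^ d * k_{s²}(x, y)` at points of distance at most `s` that are not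
too far out. -/
noncomputable def nearConst (d : ℕ) : ℝ :=
  1 / (2 * Real.pi) ^ ((d : ℝ) / 2) * Real.exp (-(201 * d))

lemma nearConst_pos (d : ℕ) : 0 < nearConst d := by
  have := Real.pi_pos
  unfold nearConst
  positivity

/-- The Gaussian exponent is at least `-d`. Since `α(s²) ≤ s²/4`, the other exponent is at least
`-(25/2) d (sr)² ≥ -200 d`. -/
lemma nearConst_div_le_oscKernel {s r : ℝ} {x y : E d} (hs : 0 < s) (hr : 0 < r)
    (hsr : s * r ≤ 4) (hxy : ∀ i, |x i - y i| ≤ s) (hx : ∀ i, |x i| ≤ 5 * r)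
    (hy : ∀ i, |y i| ≤ 5 * r) : nearConst d / s ^ d ≤ oscKernel (s ^ 2) x y := by
  have hpi := Real.pi_pos
  have h₁ : (2 * Real.pi * s ^ 2) ^ ((d : ℝ) / 2) = (2 * Real.pi) ^ ((d : ℝ) / 2) * s ^ d := by
    rw [Real.mul_rpow (by positivity) (by positivity), ← Real.rpow_natCast s 2,
      ← Real.rpow_mul hs.le, ← Real.rpow_natCast s d]
    congr 2
    push_cast
    ring
  have h₂ : ‖x - y‖ ^ 2 ≤ d * s ^ 2 := norm_sq_le_of_abs_le fun i => by simpa using hxy i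
  have h₃ := norm_sq_le_of_abs_le hx
  have h₄ := norm_sq_le_of_abs_le hy
  have h₅ : -(d : ℝ) ≤ -‖x - y‖ ^ 2 / (2 * s ^ 2) := by
    rw [le_div_iff₀ (by positivity)]
    nlinarith [sq_nonneg ‖x - y‖]
  have h₆ : alpha (s ^ 2) * (‖x‖ ^ 2 + ‖y‖ ^ 2) ≤ 200 * d := by
    calc alpha (s ^ 2) * (‖x‖ ^ 2 + ‖y‖ ^ 2)
        ≤ s ^ 2 / 4 * (d * (5 * r) ^ 2 + d * (5 * r) ^ 2) := by
          gcongr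
          exact alpha_le (by positivity)
      _ = 25 / 2 * d * (s * r) ^ 2 := by ring
      _ ≤ 25 / 2 * d * 4 ^ 2 := by gcongr
      _ = 200 * d := by ring
  rw [oscKernel, h₁, nearConst, mul_assoc (1 / _), ← Real.exp_add]
  calc _ = 1 / ((2 * Real.pi) ^ ((d : ℝ) / 2) * s ^ d) * Real.exp (-(201 * d)) := by
        field_simp
    _ ≤ _ := by
        gcongr
        linarith

/-- The cube of half-side `(n + 1)√t` centred at `x`. -/
def concentricCube (x : E d) (t : ℝ) (n : ℕ) : Set (E d) :=
  cube (fun i => x i - (n + 1) * √t) (2 * ((n + 1) * √t))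

/-- The decay of the heat kernel at time `t` on the cubes `concentricCube x t n`. -/
noncomputable def heatCoeff (d n : ℕ) : ℝ := (2 * (n + 1)) ^ d * Real.exp (-(n / 2))

lemma summable_heatCoeff (d : ℕ) : Summable (heatCoeff d) := by
  have h := Real.summable_pow_mul_exp_neg_nat_mul d (r := 1 / 2) (by norm_num)
  have h' := ((summable_nat_add_iff 1).2 h).mul_left (2 ^ d * Real.exp (1 / 2))
  refine h'.congr fun n => ?_
  rw [heatCoeff, mul_pow]
  push_cast
  have : Real.exp (-(n / 2 : ℝ)) = Real.exp (1 / 2) * Real.exp (-(1 / 2) * (n + 1)) := by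
    rw [← Real.exp_add]
    congr 1
    ring
  rw [this]
  ring

lemma tsum_heatCoeff_ne_top (d : ℕ) : ∑' n, ENNReal.ofReal (heatCoeff d n) ≠ ∞ :=
  (summable_heatCoeff d).tsum_ofReal_ne_top

lemma volume_concentricCube (x : E d) (t : ℝ) (n : ℕ) :
    volume (concentricCube x t n) = ENNReal.ofReal ((2 * ((n + 1) * √t)) ^ d) := by
  rw [concentricCube, volume_cube, ENNReal.ofReal_pow (by positivity)]

/-- One term of the sum suffices, that of the shell `n√t ≤ |x-y| < (n+1)√t` containing `y`; there
the Gaussian is at most `exp(-n²/2) ≤ exp(-n/2)`. -/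
lemma oscKernel_le_tsum {t : ℝ} (ht : 0 < t) (x y : E d) :
    ENNReal.ofReal (oscKernel t x y) ≤ ∑' n, ENNReal.ofReal (heatCoeff d n) *
      (concentricCube x t n).indicator (fun _ => (volume (concentricCube x t n))⁻¹) y := by
  have hpi := Real.pi_pos
  have hst : 0 < √t := Real.sqrt_pos.2 ht
  set n := ⌊‖x - y‖ / √t⌋₊ with hn
  have h₁ : (n : ℝ) * √t ≤ ‖x - y‖ :=
    (le_div_iff₀ hst).1 (Nat.floor_le (by positivity))
  have h₂ : ‖x - y‖ < (n + 1) * √t := (div_lt_iff₀ hst).1 (Nat.lt_floor_add_one _)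
  have hy : y ∈ concentricCube x t n := by
    intro i
    have h : |x i - y i| < (n + 1) * √t :=
      (show |x i - y i| ≤ ‖x - y‖ by simpa using PiLp.norm_apply_le (x - y) i).trans_lt h₂
    rw [abs_lt] at h
    constructor <;> linarith
  refine le_trans ?_ (ENNReal.le_tsum n)
  rw [indicator_of_mem hy, volume_concentricCube, ← ENNReal.ofReal_inv_of_pos (by positivity),
    ← ENNReal.ofReal_mul (by unfold heatCoeff; positivity)]
  apply ENNReal.ofReal_le_ofReal
  have h₃ : (√t) ^ d ≤ (2 * Real.pi * t) ^ ((d : ℝ) / 2) := by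
    have : (√t) ^ d = t ^ ((d : ℝ) / 2) := by
      rw [Real.sqrt_eq_rpow, ← Real.rpow_natCast, ← Real.rpow_mul ht.le]
      congr 1
      ring
    rw [this]
    gcongr
    nlinarith [Real.pi_gt_three]
  have h₄ : -‖x - y‖ ^ 2 / (2 * t) ≤ -(n / 2) := by
    have h₅ : (n : ℝ) ≤ n ^ 2 := by exact_mod_cast Nat.le_self_pow two_ne_zero n
    have h₆ : ((n : ℝ) * √t) ^ 2 ≤ ‖x - y‖ ^ 2 := by gcongr
    rw [mul_pow, Real.sq_sqrt ht.le] at h₆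
    rw [div_le_iff₀ (by positivity)]
    nlinarith
  have h₇ : Real.exp (-(alpha t) * (‖x‖ ^ 2 + ‖y‖ ^ 2)) ≤ 1 := by
    rw [Real.exp_le_one_iff, neg_mul, neg_nonpos]
    have := alpha_nonneg ht
    positivity
  calc oscKernel t x y ≤ 1 / (√t) ^ d * Real.exp (-(n / 2)) * 1 := by
        unfold oscKernel
        gcongr
    _ = heatCoeff d n * ((2 * ((n + 1) * √t)) ^ d)⁻¹ := by
        rw [heatCoeff, ← mul_assoc 2, mul_pow _ (√t)]
        field_simp

/-! ### Pointwise bounds for the maximal operators -/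

lemma lintegral_le_oscMaximal {t : ℝ} (ht : 0 < t) (f : E d → ℝ) (x : E d) :
    ∫⁻ y, ENNReal.ofReal (oscKernel t x y) * ‖f y‖ₑ ≤ oscMaximal f x := by
  have h : Real.sinh (2 * (Real.arsinh t / 2)) = t := by
    rw [mul_div_cancel₀ _ two_ne_zero, Real.sinh_arsinh]
  have h' := le_iSup₂_of_le (f := fun (t : ℝ) (_ : 0 < t) => oscSemigroup t f x)
    (Real.arsinh t / 2) (half_pos (Real.arsinh_pos_iff.2 ht)) le_rfl
  refine le_trans (le_of_eq ?_) h'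
  simp only [oscSemigroup, h]

lemma mul_setLIntegral_le_oscMaximal {f : E d → ℝ} (hf : AEMeasurable f) {x : E d} {A : Set (E d)}
    (hA : MeasurableSet A) {t c : ℝ} (ht : 0 < t) (h : ∀ y ∈ A, c ≤ oscKernel t x y) :
    ENNReal.ofReal c * ∫⁻ y in A, ‖f y‖ₑ ≤ oscMaximal f x := by
  rw [← lintegral_const_mul'' _ hf.enorm.restrict]
  calc _ ≤ ∫⁻ y in A, ENNReal.ofReal (oscKernel t x y) * ‖f y‖ₑ := by
        refine setLIntegral_mono' hA fun y hy => ?_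
        gcongr
        exact h y hy
    _ ≤ _ := setLIntegral_le_lintegral _ _
    _ ≤ _ := lintegral_le_oscMaximal ht f x

/-- The far cubes are disjoint, so the sum at time `t` is at most the integral of `k_t(x,·)|f|` over
their union. -/
lemma farMaximalMinus_le_oscMaximal {𝒩 : Set (E d) → Set (Set (E d))} {f : E d → ℝ}
    (hf : AEMeasurable f) (x : E d) : farMaximalMinus 𝒩 f x ≤ oscMaximal f x := by
  refine iSup₂_le fun t ht => ?_
  have hc : Countable (farFamily 𝒩 t (gridCube x)) := (countable_farFamily 𝒩 t _).to_subtype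
  have hmeas (S : farFamily 𝒩 t (gridCube x)) : MeasurableSet (S : Set (E d)) :=
    measurableSet_of_mem_gaussianGrid S.2.1.1
  calc _ ≤ ∑' S : farFamily 𝒩 t (gridCube x),
        ∫⁻ y in (S : Set (E d)), ENNReal.ofReal (oscKernel t x y) * ‖f y‖ₑ := by
        refine ENNReal.tsum_le_tsum fun S => ?_
        rw [← lintegral_const_mul'' _ hf.enorm.restrict]
        refine setLIntegral_mono' (hmeas S) fun y hy => ?_
        gcongr
        exact (iInf₂_le x (mem_gridCube x)).trans (iInf₂_le y hy)
    _ = ∫⁻ y in ⋃ S : farFamily 𝒩 t (gridCube x), (S : Set (E d)),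
        ENNReal.ofReal (oscKernel t x y) * ‖f y‖ₑ := by
        refine (lintegral_iUnion hmeas (fun S S' hne => ?_) _).symm
        refine disjoint_left.2 fun y hy hy' => hne (Subtype.ext ?_)
        exact eq_of_mem_gaussianGrid S.2.1.1 S'.2.1.1 hy hy'
    _ ≤ _ := setLIntegral_le_lintegral _ _
    _ ≤ _ := lintegral_le_oscMaximal ht f x

lemma volume_cube_ne_zero (a : Fin d → ℝ) {s : ℝ} (hs : 0 < s) :
    volume (cube a s) ≠ 0 := by
  rw [volume_cube]
  exact pow_ne_zero _ (ENNReal.ofReal_pos.2 hs).ne'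

lemma ofReal_div_pow {c s : ℝ} (hs : 0 < s) (n : ℕ) :
    ENNReal.ofReal (c / s ^ n) = ENNReal.ofReal c / ENNReal.ofReal s ^ n := by
  rw [ENNReal.ofReal_div_of_pos (by positivity), ENNReal.ofReal_pow hs.le]

lemma locPart_hardyLittlewood_le {𝒩 : Set (E d) → Set (Set (E d))} (h𝒩 : IsNearSystem 𝒩)
    {f : E d → ℝ} (hf : AEMeasurable f) (x : E d) :
    ENNReal.ofReal (nearConst d) * locPart 𝒩 hardyLittlewood f x ≤ oscMaximal f x := by
  have hR := gridCube_mem x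
  have hN := measurableSet_near h𝒩 hR
  have hxN := subset_near h𝒩 hR (mem_gridCube x)
  set N := ⋃₀ 𝒩 (gridCube x) with hNdef
  set r : ℝ := 2 ^ layerIndex (gridCube x) with hr
  have hr0 : 0 < r := by positivity
  have hL : 4 * (2 : ℝ) ^ (-(layerIndex (gridCube x) : ℤ)) = 4 / r := by
    rw [zpow_neg, zpow_natCast, ← hr, div_eq_mul_inv]
  rw [locPart, hardyLittlewood, ENNReal.mul_iSup]
  refine iSup_le fun Q => ?_
  rw [ENNReal.mul_iSup]
  refine iSup_le ?_
  rintro ⟨⟨s, hs, a, rfl⟩, hxQ⟩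
  -- `Q` may be much larger than `N`, but only `Q ∩ N` contributes. Its points differ by at most `σ`
  -- in each coordinate, and `σ ≤ s` turns `σ^{-d}` into a bound for `1/|Q|`.
  set σ := min s (4 / r) with hσ
  have hσ0 : 0 < σ := by positivity
  have hσr : σ * r ≤ 4 := (le_div_iff₀ hr0).1 (min_le_right _ _)
  have hQ := measurableSet_cube a s
  have hint : ∫⁻ y in cube a s, ‖N.indicator f y‖ₑ = ∫⁻ y in cube a s ∩ N, ‖f y‖ₑ := by
    simp_rw [enorm_indicator_eq_indicator_enorm]
    rw [lintegral_indicator hN, Measure.restrict_restrict hN, inter_comm]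
  have hmain := mul_setLIntegral_le_oscMaximal hf (x := x) (hQ.inter hN) (t := σ ^ 2)
    (by positivity) (c := nearConst d / σ ^ d) fun y hy =>
      nearConst_div_le_oscKernel hσ0 hr0 hσr
        (fun i => le_min (abs_sub_le_of_mem_cube hxQ hy.1 i)
          ((abs_sub_le_of_mem_near h𝒩 hR hxN hy.2 i).trans_eq hL))
        (abs_le_of_mem_near h𝒩 hR hxN) (abs_le_of_mem_near h𝒩 hR hy.2)
  refine le_trans ?_ hmain
  rw [hint, volume_cube, ofReal_div_pow hσ0, div_eq_mul_inv, div_eq_mul_inv, mul_assoc,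
    mul_comm (∫⁻ y in _, _)]
  gcongr
  exact min_le_left _ _

lemma lintegral_near_le {A : Set (E d)} (hA : MeasurableSet A) {f : E d → ℝ}
    (hf : AEMeasurable f) {t : ℝ} (ht : 0 < t) (x : E d) :
    ∫⁻ y in A, ENNReal.ofReal (oscKernel t x y) * ‖f y‖ₑ ≤
      (∑' n, ENNReal.ofReal (heatCoeff d n)) * hardyLittlewood (A.indicator f) x := by
  have hcube (n : ℕ) : MeasurableSet (concentricCube x t n) := measurableSet_cube _ _
  have hst : 0 < √t := Real.sqrt_pos.2 ht
  have hg : AEMeasurable fun y => ‖A.indicator f y‖ₑ := (hf.indicator hA).enorm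
  calc _ = ∫⁻ y, ENNReal.ofReal (oscKernel t x y) * ‖A.indicator f y‖ₑ := by
        rw [← lintegral_indicator hA]
        refine lintegral_congr fun y => ?_
        by_cases hy : y ∈ A <;> simp [hy]
    _ ≤ ∫⁻ y, ∑' n, ENNReal.ofReal (heatCoeff d n) *
        ((concentricCube x t n).indicator (fun _ => (volume (concentricCube x t n))⁻¹) y *
          ‖A.indicator f y‖ₑ) := by
        refine lintegral_mono fun y => ?_
        simp_rw [← mul_assoc]
        rw [ENNReal.tsum_mul_right]
        gcongr
        exact oscKernel_le_tsum ht x y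
    _ = ∑' n, ENNReal.ofReal (heatCoeff d n) * ((∫⁻ y in concentricCube x t n,
          ‖A.indicator f y‖ₑ) / volume (concentricCube x t n)) := by
        have hi (n : ℕ) : AEMeasurable fun y => ENNReal.ofReal (heatCoeff d n) *
            ((concentricCube x t n).indicator (fun _ => (volume (concentricCube x t n))⁻¹) y *
              ‖A.indicator f y‖ₑ) :=
          ((measurable_const.indicator (hcube n)).aemeasurable.mul hg).const_mul _
        rw [lintegral_tsum hi]
        congr 1 with n
        rw [lintegral_const_mul' _ _ ENNReal.ofReal_ne_top, div_eq_mul_inv,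
          ← lintegral_mul_const'' _ hg.restrict, ← lintegral_indicator (hcube n)]
        congr 2 with y
        by_cases hy : y ∈ concentricCube x t n <;> simp [hy, mul_comm]
    _ ≤ ∑' n, ENNReal.ofReal (heatCoeff d n) * hardyLittlewood (A.indicator f) x := by
        refine ENNReal.tsum_le_tsum fun n => ?_
        gcongr
        refine le_iSup₂_of_le (concentricCube x t n) ⟨⟨_, by positivity, _, rfl⟩, fun i => ?_⟩ le_rfl
        have : 0 < (n + 1) * √t := by positivity
        constructor <;> linarith
    _ = _ := ENNReal.tsum_mul_right

lemma lintegral_far_le {𝒩 : Set (E d) → Set (Set (E d))} {f : E d → ℝ} {t : ℝ} (ht : 0 < t)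
    (x : E d) :
    ∫⁻ y in farCube t (gridCube x) \ ⋃₀ 𝒩 (gridCube x),
        ENNReal.ofReal (oscKernel t x y) * ‖f y‖ₑ ≤ farMaximalPlus 𝒩 f x := by
  have hc : Countable (farFamily 𝒩 t (gridCube x)) := (countable_farFamily 𝒩 t _).to_subtype
  have hmeas (S : farFamily 𝒩 t (gridCube x)) : MeasurableSet (S : Set (E d)) :=
    measurableSet_of_mem_gaussianGrid S.2.1.1
  -- Finiteness of the supremum lets it be taken out of the integral without measurability of `f`.
  have hfin (S : Set (E d)) : kernelSup t (gridCube x) S ≠ ∞ := by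
    refine ne_top_of_le_ne_top
      (ENNReal.ofReal_ne_top (r := 1 / (2 * Real.pi * t) ^ ((d : ℝ) / 2) * 1 * 1)) ?_
    refine iSup₂_le fun u _ => iSup₂_le fun v _ => ENNReal.ofReal_le_ofReal ?_
    have hα := alpha_nonneg ht
    have hpi := Real.pi_pos
    unfold oscKernel
    gcongr
    · rw [Real.exp_le_one_iff, neg_div, neg_nonpos]
      positivity
    · rw [Real.exp_le_one_iff, neg_mul, neg_nonpos]
      positivity
  calc _ ≤ ∫⁻ y in ⋃ S : farFamily 𝒩 t (gridCube x), (S : Set (E d)),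
        ENNReal.ofReal (oscKernel t x y) * ‖f y‖ₑ := by
        refine lintegral_mono_set fun y hy => mem_iUnion.2 ?_
        exact ⟨⟨_, gridCube_mem_farFamily hy.2 hy.1⟩, mem_gridCube y⟩
    _ ≤ ∑' S : farFamily 𝒩 t (gridCube x),
        ∫⁻ y in (S : Set (E d)), ENNReal.ofReal (oscKernel t x y) * ‖f y‖ₑ :=
        lintegral_iUnion_le _ _
    _ ≤ ∑' S : farFamily 𝒩 t (gridCube x),
        kernelSup t (gridCube x) S * ∫⁻ y in (S : Set (E d)), ‖f y‖ₑ := by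
        refine ENNReal.tsum_le_tsum fun S => ?_
        rw [← lintegral_const_mul' _ _ (hfin S)]
        refine setLIntegral_mono' (hmeas S) fun y hy => ?_
        gcongr
        exact le_iSup₂_of_le x (mem_gridCube x) (le_iSup₂_of_le y hy le_rfl)
    _ ≤ _ := le_iSup₂_of_le (f := fun (t : ℝ) (_ : 0 < t) =>
        ∑' S : farFamily 𝒩 t (gridCube x), kernelSup t (gridCube x) S *
          ∫⁻ y in (S : Set (E d)), ‖f y‖ₑ) t ht le_rfl

/-- The times `t, 2m, 4m, …` with `m = max(t, 2⁴d²)`, whose cubes `Q_t(R)` exhaust `ℝ^d`. -/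
noncomputable def farTime (d : ℕ) (t : ℝ) : ℕ → ℝ
  | 0 => t
  | i + 1 => 2 ^ (i + 1) * max t (2 ^ 4 * (d : ℝ) ^ 2)

lemma farTime_pos {t : ℝ} (ht : 0 < t) (i : ℕ) : 0 < farTime d t i := by
  cases i with
  | zero => exact ht
  | succ i =>
    have : 0 < max t (2 ^ 4 * (d : ℝ) ^ 2) := lt_max_of_lt_left ht
    unfold farTime
    positivity

lemma exists_farTime (hd : 1 ≤ d) {t : ℝ} (ht : 0 < t) (x y : E d) :
    ∃ i, y ∈ farCube (farTime d t i) (gridCube x) ∧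
      oscKernel t x y ≤ d.factorial * (1 / 2) ^ i * oscKernel (farTime d t i) x y := by
  classical
  have hpos : ∀ s (z : E d), 0 < s → 0 ≤ oscKernel s x z := by
    intro s z hs
    have := Real.pi_pos
    unfold oscKernel
    positivity
  set m := max t (2 ^ 4 * (d : ℝ) ^ 2) with hm
  set r : ℝ := 2 ^ layerIndex (gridCube x) with hr
  have hd1 : (1 : ℝ) ≤ d := by exact_mod_cast hd
  have hr1 : 1 ≤ r := one_le_pow₀ one_le_two
  have hmd : 2 ^ 4 * (d : ℝ) ^ 2 ≤ m := le_max_right _ _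
  have hmd' : (d : ℝ) ≤ m := by nlinarith
  have hmt : t ≤ m := le_max_left _ _
  have hm1 : 1 ≤ m := hd1.trans hmd'
  have hex : ∃ i : ℕ, ‖y‖ ≤ 2 ^ 8 * (2 ^ i * m) ^ 2 * r := by
    obtain ⟨n, hn⟩ := pow_unbounded_of_one_lt ‖y‖ (one_lt_two (α := ℝ))
    have h2 : (1 : ℝ) ≤ 2 ^ n := one_le_pow₀ one_le_two
    refine ⟨n, hn.le.trans ?_⟩
    calc (2 : ℝ) ^ n ≤ 2 ^ n * m := le_mul_of_one_le_right (by positivity) hm1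
      _ ≤ (2 ^ n * m) ^ 2 := le_self_pow₀ (by nlinarith) two_ne_zero
      _ ≤ 2 ^ 8 * (2 ^ n * m) ^ 2 * r := by
        rw [mul_right_comm]
        exact le_mul_of_one_le_left (by positivity) (by nlinarith)
  -- For the least `i`, the bound holds at `i` and puts `y` in the far cube. For `i ≥ 1` it fails at
  -- `i - 1`, and halving the time turns `2^8` into `64`, which is the hypothesis of
  -- `oscKernel_le_of_far`.
  set i := Nat.find hex with hi
  have hle : ‖y‖ ≤ 2 ^ 8 * (2 ^ i * m) ^ 2 * r := Nat.find_spec hex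
  rcases hcase : i with _ | k
  · refine ⟨0, mem_farCube_of_norm_le ?_, ?_⟩
    · simpa [hcase, farTime] using hle
    · have h₁ : (1 : ℝ) ≤ d.factorial := by exact_mod_cast Nat.one_le_iff_ne_zero.2 d.factorial_ne_zero
      simpa [farTime] using le_mul_of_one_le_left (hpos t y ht) h₁
  · have hlt : 2 ^ 8 * (2 ^ k * m) ^ 2 * r < ‖y‖ :=
      not_le.1 (Nat.find_min hex (show k < Nat.find hex by omega))
    have hT : farTime d t (k + 1) = 2 ^ (k + 1) * m := rfl
    set T := farTime d t (k + 1) with hTdef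
    have hk1 : (1 : ℝ) ≤ 2 ^ k := one_le_pow₀ one_le_two
    have hTm : 2 * m ≤ T := by
      rw [hT, pow_succ]
      nlinarith
    have hT0 : 0 < T := by linarith
    have hy : 64 * T ^ 2 * r ≤ ‖y‖ := by
      refine le_trans (le_of_eq ?_) hlt.le
      rw [hT]
      ring
    have hx : ‖x‖ ≤ d * r := by
      have h := norm_sq_le_of_abs_le (abs_le_two_pow_layerIndex (gridCube_mem x) (mem_gridCube x))
      refine le_of_sq_le_sq (h.trans ?_) (by positivity)
      rw [mul_pow]
      gcongr
      nlinarith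
    refine ⟨k + 1, mem_farCube_of_norm_le ?_, ?_⟩
    · rw [← hTdef, max_eq_left (by linarith), hT, ← hcase]
      exact hle
    · refine (oscKernel_le_of_far hd ht (t := T) (by linarith) (by linarith) ?_ ?_).trans ?_
      · refine le_trans ?_ hy
        calc 16 * T * ‖x‖ ≤ 16 * T * (T * r) := by
              gcongr
              exact hx.trans (by gcongr; linarith)
          _ ≤ 64 * T ^ 2 * r := by nlinarith [mul_pos (pow_pos hT0 2) (by linarith : 0 < r)]
      · exact le_trans (le_mul_of_one_le_right (by positivity) hr1) hy
      · have h₁ : (1 : ℝ) / T ≤ (1 / 2) ^ (k + 1) := by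
          rw [one_div_pow]
          refine one_div_le_one_div_of_le (by positivity) ?_
          rw [hT]
          exact le_mul_of_one_le_right (by positivity) hm1
        rw [div_eq_mul_one_div]
        have := hpos T y hT0
        gcongr

lemma oscMaximal_le (hd : 1 ≤ d) {𝒩 : Set (E d) → Set (Set (E d))} (h𝒩 : IsNearSystem 𝒩)
    {f : E d → ℝ} (hf : AEMeasurable f) (x : E d) :
    oscMaximal f x ≤ (∑' n, ENNReal.ofReal (heatCoeff d n)) * locPart 𝒩 hardyLittlewood f x +
      (2 * d.factorial) * farMaximalPlus 𝒩 f x := by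
  refine iSup₂_le fun τ hτ => ?_
  have ht : 0 < Real.sinh (2 * τ) := Real.sinh_pos_iff.2 (by linarith)
  set t := Real.sinh (2 * τ) with htdef
  have hN := measurableSet_near h𝒩 (gridCube_mem x)
  rw [oscSemigroup, ← lintegral_add_compl _ hN]
  gcongr
  · exact lintegral_near_le hN hf ht x
  set N := ⋃₀ 𝒩 (gridCube x) with hNdef
  have hc (i : ℕ) : MeasurableSet (farCube (farTime d t i) (gridCube x)) :=
    measurableSet_of_gridCube_subset fun _ => gridCube_subset_smallestCube
  let g (i : ℕ) (y : E d) : ℝ≥0∞ := ENNReal.ofReal (oscKernel (farTime d t i) x y) * ‖f y‖ₑ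
  have hg (i : ℕ) : AEMeasurable (g i) :=
    (measurable_oscKernel _ x).ennreal_ofReal.aemeasurable.mul hf.enorm
  have hcoe (i : ℕ) : ENNReal.ofReal (d.factorial * (1 / 2) ^ i) =
      d.factorial * (2⁻¹ : ℝ≥0∞) ^ i := by
    rw [ENNReal.ofReal_mul (by positivity), ENNReal.ofReal_natCast,
      ENNReal.ofReal_pow (by positivity), one_div, ENNReal.ofReal_inv_of_pos two_pos,
      ENNReal.ofReal_ofNat]
  -- The index `i` depends on `y`; summing over all `i` avoids a measurable selection, and the
  -- geometric series costs only a factor `2`.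
  calc ∫⁻ y in Nᶜ, ENNReal.ofReal (oscKernel t x y) * ‖f y‖ₑ
      ≤ ∫⁻ y in Nᶜ, ∑' i, (d.factorial * (2⁻¹ : ℝ≥0∞) ^ i) *
          (farCube (farTime d t i) (gridCube x)).indicator (g i) y := by
        refine lintegral_mono fun y => ?_
        obtain ⟨i, hi, hle⟩ := exists_farTime hd ht x y
        refine le_trans ?_ (ENNReal.le_tsum i)
        rw [indicator_of_mem hi, ← mul_assoc, ← hcoe, ← ENNReal.ofReal_mul (by positivity)]
        gcongr
    _ = ∑' i, (d.factorial * (2⁻¹ : ℝ≥0∞) ^ i) *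
          ∫⁻ y in farCube (farTime d t i) (gridCube x) \ N, g i y := by
        rw [lintegral_tsum fun i => ((hg i).indicator (hc i)).restrict.const_mul _]
        congr 1 with i
        rw [lintegral_const_mul'' _ ((hg i).indicator (hc i)).restrict, lintegral_indicator (hc i),
          Measure.restrict_restrict (hc i), sdiff_eq]
    _ ≤ ∑' i, (d.factorial * (2⁻¹ : ℝ≥0∞) ^ i) * farMaximalPlus 𝒩 f x := by
        refine ENNReal.tsum_le_tsum fun i => ?_
        gcongr
        exact lintegral_far_le (farTime_pos ht i) x
    _ = _ := by
        rw [ENNReal.tsum_mul_right, ENNReal.tsum_mul_left, ENNReal.tsum_geometric,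
          ENNReal.one_sub_inv_two, inv_inv, mul_comm (d.factorial : ℝ≥0∞)]

/-! ### Boundedness on weighted spaces -/

lemma IsWeight.aemeasurable {w : E d → ℝ} (hw : IsWeight w) : AEMeasurable w :=
  hw.1.aestronglyMeasurable.aemeasurable

/-- Because `w > 0` almost everywhere, functions measurable for `w dx` are also measurable for
Lebesgue measure, as the pointwise bounds require. -/
lemma IsWeight.volume_absolutelyContinuous {w : E d → ℝ} (hw : IsWeight w) :
    volume ≪ weightMeasure w :=
  withDensity_absolutelyContinuous' hw.aemeasurable.ennreal_ofReal
    (hw.2.mono fun _ hx => (ENNReal.ofReal_pos.2 hx).ne')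

lemma IsWeight.aemeasurable_of_memLp {w : E d → ℝ} (hw : IsWeight w) {f : E d → ℝ} {q : ℝ≥0∞}
    (hf : MemLp f q (weightMeasure w)) : AEMeasurable f :=
  hf.1.aemeasurable.mono_ac hw.volume_absolutelyContinuous

/-- The function is constant on each grid cube, so every preimage is a union of grid cubes. -/
lemma measurable_farMaximalPlus (𝒩 : Set (E d) → Set (Set (E d))) (f : E d → ℝ) :
    Measurable (farMaximalPlus 𝒩 f) := by
  refine fun B _ => measurableSet_of_gridCube_subset fun y hy z hz => ?_
  rw [mem_preimage, farMaximalPlus, gridCube_eq (gridCube_mem y) hz]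
  exact hy

lemma eLpNorm_ofReal_eq {p : ℝ} (hp : 0 < p) {ε : Type*} [ENorm ε] (μ : Measure (E d))
    (f : E d → ε) : eLpNorm f (ENNReal.ofReal p) μ = (∫⁻ x, ‖f x‖ₑ ^ p ∂μ) ^ (1 / p) := by
  rw [eLpNorm_eq_lintegral_rpow_enorm_toReal (ENNReal.ofReal_pos.2 hp).ne' ENNReal.ofReal_ne_top,
    ENNReal.toReal_ofReal hp.le]

/-- Convexity of the `p`-th power replaces the triangle inequality, so that only `B` has to be
measurable. It is applied with `A` the local maximal function, whose measurability is then not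
needed. -/
lemma eLpNorm_le_of_le_add {p : ℝ} (hp : 1 ≤ p) {μ : Measure (E d)} {S A B : E d → ℝ≥0∞}
    (hB : Measurable B) {a b : ℝ≥0∞} (ha : a ≠ ∞) (hb : b ≠ ∞)
    (h : ∀ x, S x ≤ a * A x + b * B x) :
    eLpNorm S (ENNReal.ofReal p) μ ≤ (2 ^ (p - 1)) ^ (1 / p) *
      (a * eLpNorm A (ENNReal.ofReal p) μ + b * eLpNorm B (ENNReal.ofReal p) μ) := by
  have hp0 : 0 < p := by linarith
  have hroot (c I : ℝ≥0∞) : (c ^ p * I) ^ (1 / p) = c * I ^ (1 / p) := by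
    rw [ENNReal.mul_rpow_of_nonneg _ _ (by positivity), ← ENNReal.rpow_mul,
      mul_one_div_cancel hp0.ne', ENNReal.rpow_one]
  simp only [eLpNorm_ofReal_eq hp0, enorm_eq_self]
  rw [← hroot a, ← hroot b]
  calc (∫⁻ x, S x ^ p ∂μ) ^ (1 / p)
      ≤ (∫⁻ x, 2 ^ (p - 1) * (a ^ p * A x ^ p + b ^ p * B x ^ p) ∂μ) ^ (1 / p) := by
        gcongr with x
        refine (ENNReal.rpow_le_rpow (h x) hp0.le).trans ?_
        refine (ENNReal.rpow_add_le_mul_rpow_add_rpow _ _ hp).trans ?_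
        rw [ENNReal.mul_rpow_of_nonneg _ _ hp0.le, ENNReal.mul_rpow_of_nonneg _ _ hp0.le]
    _ = (2 ^ (p - 1) * (a ^ p * ∫⁻ x, A x ^ p ∂μ + b ^ p * ∫⁻ x, B x ^ p ∂μ)) ^ (1 / p) := by
        rw [lintegral_const_mul' _ _ (by finiteness),
          lintegral_add_right _ ((hB.pow_const p).const_mul _),
          lintegral_const_mul' _ _ (by finiteness), lintegral_const_mul' _ _ (by finiteness)]
    _ ≤ _ := by
        rw [ENNReal.mul_rpow_of_nonneg _ _ (by positivity)]
        gcongr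
        exact ENNReal.rpow_add_le_add_rpow _ _ (by positivity)
          (by rw [div_le_one hp0]; exact hp)

lemma BoundedOnLp.of_le_add {p : ℝ} (hp : 1 ≤ p) {w : E d → ℝ} (hw : IsWeight w)
    {S A B : (E d → ℝ) → E d → ℝ≥0∞} (hA : BoundedOnLp p w A) (hB : BoundedOnLp p w B)
    (hBm : ∀ f, Measurable (B f)) {a b : ℝ≥0∞} (ha : a ≠ ∞) (hb : b ≠ ∞)
    (h : ∀ f, AEMeasurable f → ∀ x, S f x ≤ a * A f x + b * B f x) : BoundedOnLp p w S := by
  obtain ⟨C, hC⟩ := hA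
  obtain ⟨D, hD⟩ := hB
  have hp0 : 0 ≤ 1 / p := by positivity
  have hfin : (2 ^ (p - 1)) ^ (1 / p) * (a * C + b * D) ≠ ∞ := by finiteness
  refine ⟨((2 ^ (p - 1)) ^ (1 / p) * (a * C + b * D)).toNNReal, fun f hf => ?_⟩
  rw [ENNReal.coe_toNNReal hfin]
  calc _ ≤ (2 ^ (p - 1)) ^ (1 / p) * (a * eLpNorm (A f) (ENNReal.ofReal p) (weightMeasure w) +
        b * eLpNorm (B f) (ENNReal.ofReal p) (weightMeasure w)) :=
        eLpNorm_le_of_le_add hp (hBm f) ha hb (h f (hw.aemeasurable_of_memLp hf))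
    _ ≤ (2 ^ (p - 1)) ^ (1 / p) * (a * (C * eLpNorm f (ENNReal.ofReal p) (weightMeasure w)) +
        b * (D * eLpNorm f (ENNReal.ofReal p) (weightMeasure w))) := by
        gcongr
        · exact hC f hf
        · exact hD f hf
    _ = _ := by ring

lemma BoundedOnLp.of_le {p : ℝ} (hp : 1 ≤ p) {w : E d → ℝ} (hw : IsWeight w)
    {S A : (E d → ℝ) → E d → ℝ≥0∞} (hA : BoundedOnLp p w A) {a : ℝ≥0∞} (ha : a ≠ ∞)
    (h : ∀ f, AEMeasurable f → ∀ x, S f x ≤ a * A f x) : BoundedOnLp p w S := by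
  refine of_le_add hp hw hA (B := fun _ _ => 0) ⟨0, fun f _ => ?_⟩ (fun _ => measurable_const) ha
    ENNReal.zero_ne_top (by simpa using h)
  simp [eLpNorm_ofReal_eq (show 0 < p by linarith), show 0 < p by linarith]

/-! ### The local dyadic condition -/

/-- The power `w^{-1/(p-1)}`, truncated at height `(n + 1)^{1/(p-1)}`. -/
noncomputable def truncDual (p : ℝ) (w : E d → ℝ) (n : ℕ) (y : E d) : ℝ :=
  max (w y) (1 / (n + 1)) ^ (-(1 / (p - 1)))

section TruncDual

variable {p : ℝ} {w : E d → ℝ}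

lemma truncDual_nonneg (n : ℕ) (y : E d) : 0 ≤ truncDual p w n y :=
  Real.rpow_nonneg (le_max_of_le_right (by positivity)) _

lemma aemeasurable_truncDual (hw : AEMeasurable w) (n : ℕ) : AEMeasurable (truncDual p w n) :=
  (hw.max aemeasurable_const).pow_const _

lemma truncDual_le (hp : 1 < p) (n : ℕ) (y : E d) :
    truncDual p w n y ≤ (1 / (n + 1) : ℝ) ^ (-(1 / (p - 1))) :=
  Real.rpow_le_rpow_of_nonpos (by positivity) (le_max_right _ _)
    (neg_nonpos.2 (one_div_nonneg.2 (by linarith)))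

/-- With `m = max(w, 1/(n+1))` and `σ = m^{-1/(p-1)}` one has `σ^p m = σ`, and `w ≤ m`. The
truncation makes `∫_Q σ` finite, so that a power of it can be cancelled in the testing inequality.
-/
lemma truncDual_rpow_mul_le (hp : 1 < p) (n : ℕ) (y : E d) :
    truncDual p w n y ^ p * w y ≤ truncDual p w n y := by
  have hm : 0 < max (w y) (1 / (n + 1)) := lt_max_of_lt_right (by positivity)
  have hp1 : p - 1 ≠ 0 := by linarith
  calc truncDual p w n y ^ p * w y ≤ truncDual p w n y ^ p * max (w y) (1 / (n + 1)) := by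
        gcongr
        · exact Real.rpow_nonneg (truncDual_nonneg n y) _
        · exact le_max_left _ _
    _ = truncDual p w n y := by
        rw [truncDual, ← Real.rpow_mul hm.le]
        nth_rw 2 [← Real.rpow_one (max (w y) (1 / (n + 1)))]
        rw [← Real.rpow_add hm]
        congr 1
        field_simp
        ring

lemma monotone_truncDual (hp : 1 < p) (y : E d) : Monotone fun n => truncDual p w n y := by
  intro m n hmn
  refine Real.rpow_le_rpow_of_nonpos (lt_max_of_lt_right (by positivity)) ?_
    (neg_nonpos.2 (one_div_nonneg.2 (by linarith)))
  gcongr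

lemma tendsto_truncDual {y : E d} (hy : 0 < w y) :
    Filter.Tendsto (fun n => ENNReal.ofReal (truncDual p w n y)) Filter.atTop
      (nhds (ENNReal.ofReal (w y) ^ (-(1 / (p - 1))))) := by
  refine tendsto_const_nhds.congr' ?_
  have h := tendsto_one_div_add_atTop_nhds_zero_nat (𝕜 := ℝ)
  filter_upwards [h.eventually_le_const hy] with n hn
  rw [truncDual, max_eq_left hn, ENNReal.ofReal_rpow_of_pos hy]

lemma setLIntegral_truncDual_ne_top (hp : 1 < p) {Q : Set (E d)} (hQ : volume Q ≠ ∞) (n : ℕ) :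
    ∫⁻ y in Q, ENNReal.ofReal (truncDual p w n y) ≠ ∞ := by
  refine ne_top_of_le_ne_top ?_ (lintegral_mono fun y =>
    ENNReal.ofReal_le_ofReal (truncDual_le (w := w) hp n y))
  rw [setLIntegral_const]
  finiteness

lemma eLpNorm_indicator_truncDual_le (hp : 1 < p) (hw : IsWeight w) {Q : Set (E d)}
    (hQ : MeasurableSet Q) (n : ℕ) :
    eLpNorm (Q.indicator (truncDual p w n)) (ENNReal.ofReal p) (weightMeasure w) ≤
      (∫⁻ y in Q, ENNReal.ofReal (truncDual p w n y)) ^ (1 / p) := by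
  have hp0 : 0 < p := by linarith
  have hm : AEMeasurable fun y => ‖Q.indicator (truncDual p w n) y‖ₑ ^ p :=
    (((aemeasurable_truncDual hw.aemeasurable n).indicator hQ).enorm).pow_const p
  rw [eLpNorm_ofReal_eq hp0, weightMeasure,
    lintegral_withDensity_eq_lintegral_mul₀ hw.aemeasurable.ennreal_ofReal hm,
    ← lintegral_indicator hQ]
  gcongr with y
  by_cases hy : y ∈ Q
  · have h0 := truncDual_nonneg (p := p) (w := w) n y
    simp only [Pi.mul_apply, indicator_of_mem hy]
    rw [Real.enorm_of_nonneg h0, ENNReal.ofReal_rpow_of_nonneg h0 hp0.le, mul_comm,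
      ← ENNReal.ofReal_mul (by positivity)]
    exact ENNReal.ofReal_le_ofReal (truncDual_rpow_mul_le hp n y)
  · simp [hy, hp0]

lemma memLp_indicator_truncDual (hp : 1 < p) (hw : IsWeight w) {Q : Set (E d)}
    (hQ : MeasurableSet Q) (hQf : volume Q ≠ ∞) (n : ℕ) :
    MemLp (Q.indicator (truncDual p w n)) (ENNReal.ofReal p) (weightMeasure w) := by
  have hm : AEMeasurable (Q.indicator (truncDual p w n)) :=
    (aemeasurable_truncDual hw.aemeasurable n).indicator hQ
  refine ⟨(hm.mono_ac (withDensity_absolutelyContinuous _ _)).aestronglyMeasurable, ?_⟩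
  refine (eLpNorm_indicator_truncDual_le hp hw hQ n).trans_lt ?_
  have hp0 : 0 ≤ 1 / p := by positivity
  exact ENNReal.rpow_lt_top_of_nonneg hp0 (setLIntegral_truncDual_ne_top hp hQf n)

end TruncDual

/-- A Chebyshev bound; as `g ≥ c` on all of `Q`, no measurability of `g` is needed. -/
lemma mul_rpow_le_eLpNorm {p : ℝ} (hp : 0 < p) {w : E d → ℝ} {Q : Set (E d)}
    (hQ : MeasurableSet Q) {c : ℝ≥0∞} {g : E d → ℝ≥0∞} (h : ∀ x ∈ Q, c ≤ g x) :
    c * (∫⁻ y in Q, ENNReal.ofReal (w y)) ^ (1 / p) ≤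
      eLpNorm g (ENNReal.ofReal p) (weightMeasure w) := by
  have hc : c = (c ^ p) ^ (1 / p) := by
    rw [← ENNReal.rpow_mul, mul_one_div_cancel hp.ne', ENNReal.rpow_one]
  rw [eLpNorm_ofReal_eq hp, hc, ← ENNReal.mul_rpow_of_nonneg _ _ (by positivity),
    ← withDensity_apply _ hQ]
  gcongr
  change c ^ p * weightMeasure w Q ≤ _
  rw [← setLIntegral_const]
  refine (setLIntegral_mono' hQ fun x hx => ?_).trans (setLIntegral_le_lintegral _ _)
  rw [enorm_eq_self]
  gcongr
  exact h x hx

/-- Here `F` is the integral of the truncated dual weight, `W = w(Q)^{1/p}` and `V = |Q|`; the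
hypothesis is the testing inequality, divided by `F^{1/p}`. -/
lemma rpow_mul_le_of_mul_le {p : ℝ} (hp : 1 < p) {F W κ V C : ℝ≥0∞} (hF : F ≠ ∞) (hκ : κ ≠ 0)
    (hκ' : κ ≠ ∞) (hV : V ≠ 0) (hV' : V ≠ ∞) (h : κ / V * F * W ≤ C * F ^ (1 / p)) :
    F ^ ((p - 1) / p) * W ≤ C / κ * V := by
  have hp0 : 0 < p := by linarith
  rcases eq_or_ne F 0 with rfl | hF0
  · rw [ENNReal.zero_rpow_of_pos (div_pos (by linarith) hp0), zero_mul]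
    exact zero_le
  have hsplit : F = F ^ ((p - 1) / p) * F ^ (1 / p) := by
    rw [← ENNReal.rpow_add _ _ hF0 hF]
    have : (p - 1) / p + 1 / p = 1 := by field_simp; ring
    rw [this, ENNReal.rpow_one]
  have hG0 : F ^ (1 / p) ≠ 0 := (ENNReal.rpow_pos (pos_iff_ne_zero.2 hF0) hF).ne'
  have hG : F ^ (1 / p) ≠ ∞ := ENNReal.rpow_ne_top_of_nonneg (by positivity) hF
  have h' : κ / V * (F ^ ((p - 1) / p) * W) ≤ C := by
    rw [← ENNReal.mul_le_mul_iff_left hG0 hG]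
    refine le_trans (le_of_eq ?_) h
    nth_rw 3 [hsplit]
    ring
  have hinv : V / κ * (κ / V) = 1 := by
    rw [← ENNReal.inv_div (Or.inl hV') (Or.inl hV)]
    exact ENNReal.inv_mul_cancel (ENNReal.div_pos hκ hV').ne' (ENNReal.div_ne_top hκ' hV)
  calc _ = V / κ * (κ / V * (F ^ ((p - 1) / p) * W)) := by rw [← mul_assoc, hinv, one_mul]
    _ ≤ V / κ * C := by gcongr
    _ = _ := by rw [div_eq_mul_inv, div_eq_mul_inv]; ring

lemma rpow_setLIntegral_mul_le {p : ℝ} (hp : 1 < p) {w : E d → ℝ} (hw : IsWeight w)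
    {Q : Set (E d)} {V K : ℝ≥0∞}
    (h : ∀ n, (∫⁻ y in Q, ENNReal.ofReal (truncDual p w n y)) ^ ((p - 1) / p) * V ≤ K) :
    (∫⁻ y in Q, ENNReal.ofReal (w y) ^ (-(1 / (p - 1)))) ^ ((p - 1) / p) * V ≤ K := by
  have hlim := lintegral_tendsto_of_tendsto_of_monotone (μ := volume.restrict Q)
    (fun n => (aemeasurable_truncDual (p := p) hw.aemeasurable n).ennreal_ofReal.restrict)
    (Filter.Eventually.of_forall fun y m n hmn =>
      ENNReal.ofReal_le_ofReal (monotone_truncDual hp y hmn))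
    (ae_restrict_of_ae (hw.2.mono fun y hy => tendsto_truncDual hy))
  have hlim' := hlim.ennrpow_const ((p - 1) / p)
  set J := (∫⁻ y in Q, ENNReal.ofReal (w y) ^ (-(1 / (p - 1)))) ^ ((p - 1) / p) with hJ
  -- `V` may be infinite, and multiplication by `∞` is not continuous at `0`.
  rcases eq_or_ne J 0 with h0 | h0
  · rw [h0, zero_mul]
    exact zero_le
  · exact le_of_tendsto' (ENNReal.Tendsto.mul_const hlim' (Or.inl h0)) h

lemma mem_ApLoc_of_mem_oscClass (hd : 1 ≤ d) {𝒩 : Set (E d) → Set (Set (E d))}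
    (h𝒩 : IsNearSystem 𝒩) {p : ℝ} (hp : 1 < p) {w : E d → ℝ} (h : w ∈ oscClass d p) :
    w ∈ ApLoc 𝒩 p := by
  obtain ⟨hw, C, hC⟩ := h
  have hκ : ENNReal.ofReal (nearConst d) ≠ 0 := (ENNReal.ofReal_pos.2 (nearConst_pos d)).ne'
  have hfin : (C : ℝ≥0∞) / ENNReal.ofReal (nearConst d) ≠ ∞ :=
    ENNReal.div_ne_top ENNReal.coe_ne_top hκ
  refine ⟨hw, ((C : ℝ≥0∞) / ENNReal.ofReal (nearConst d)).toNNReal, fun R hR Q hQ => ?_⟩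
  rw [ENNReal.coe_toNNReal hfin]
  have hQN := cube_subset_of_isDyadicSubcube hQ
  obtain ⟨a, s, hs, has, n, m, -, rfl⟩ := hQ
  set r : ℝ := 2 ^ layerIndex R with hr
  have hr0 : 0 < r := by positivity
  -- A subcube of `N(R)` has side at most `4 · 2^{-j(R)}`.
  have hsr : s / 2 ^ n * r ≤ 4 := by
    obtain ⟨hL, b, hb⟩ := (h𝒩 R hR).2.2
    have hsL : s = 4 / r := by
      rw [side_eq_of_cube_eq hd hs hL (has.symm.trans hb), zpow_neg, zpow_natCast, div_eq_mul_inv]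
    rw [← le_div_iff₀ hr0, ← hsL]
    exact div_le_self hs.le (one_le_pow₀ one_le_two)
  set σ := s / 2 ^ n with hσ
  have hσ0 : 0 < σ := by positivity
  set Q : Set (E d) := cube (fun i => a i + m i * σ) σ with hQdef
  have hQm : MeasurableSet Q := measurableSet_cube _ _
  have hV : volume Q = ENNReal.ofReal σ ^ d := volume_cube _ _
  have hV0 : volume Q ≠ 0 := volume_cube_ne_zero _ hσ0
  have hVf : volume Q ≠ ∞ := by rw [hV]; finiteness
  refine rpow_setLIntegral_mul_le hp hw fun k => ?_
  refine rpow_mul_le_of_mul_le hp (setLIntegral_truncDual_ne_top hp hVf k) hκ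
    ENNReal.ofReal_ne_top hV0 hVf ?_
  have hf := memLp_indicator_truncDual hp hw hQm hVf k
  refine ((mul_rpow_le_eLpNorm (by linarith) hQm fun x hx => ?_).trans (hC _ hf)).trans ?_
  · have hmain := mul_setLIntegral_le_oscMaximal (hw.aemeasurable_of_memLp hf) (x := x) hQm
      (t := σ ^ 2) (by positivity) (c := nearConst d / σ ^ d) fun y hy =>
        nearConst_div_le_oscKernel hσ0 hr0 hsr (abs_sub_le_of_mem_cube hx hy)
          (abs_le_of_mem_near h𝒩 hR (hQN hx)) (abs_le_of_mem_near h𝒩 hR (hQN hy))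
    rw [ofReal_div_pow hσ0, ← hV] at hmain
    refine le_trans (le_of_eq ?_) hmain
    congr 1
    refine setLIntegral_congr_fun hQm fun y hy => ?_
    simp only [indicator_of_mem hy]
    rw [Real.enorm_of_nonneg (truncDual_nonneg k y)]
  · gcongr
    exact eLpNorm_indicator_truncDual_le hp hw hQm k

/-! ### The remaining inclusions between the classes -/

lemma mem_oscClass_of_mem_ApPlus (hd : 1 ≤ d) {𝒩 : Set (E d) → Set (Set (E d))}
    (h𝒩 : IsNearSystem 𝒩) {p : ℝ} (hp : 1 < p) {w : E d → ℝ} (h : w ∈ ApPlus 𝒩 p) :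
    w ∈ oscClass d p :=
  ⟨h.1.1, h.2.2.of_le_add hp.le h.1.1 h.1.2 (measurable_farMaximalPlus 𝒩)
    (tsum_heatCoeff_ne_top d) (by finiteness) fun _ hf x => oscMaximal_le hd h𝒩 hf x⟩

lemma mem_ApFarMinus_of_mem_oscClass {𝒩 : Set (E d) → Set (Set (E d))} {p : ℝ} (hp : 1 < p)
    {w : E d → ℝ} (h : w ∈ oscClass d p) : w ∈ ApFarMinus 𝒩 p :=
  ⟨h.1, h.2.of_le hp.le h.1 ENNReal.one_ne_top fun _ hf x => by
    simpa using farMaximalMinus_le_oscMaximal hf x⟩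

lemma mem_locClass_of_mem_oscClass {𝒩 : Set (E d) → Set (Set (E d))} (h𝒩 : IsNearSystem 𝒩)
    {p : ℝ} (hp : 1 < p) {w : E d → ℝ} (h : w ∈ oscClass d p) : w ∈ locClass 𝒩 p := by
  have hκ : ENNReal.ofReal (nearConst d) ≠ 0 := (ENNReal.ofReal_pos.2 (nearConst_pos d)).ne'
  refine ⟨h.1, h.2.of_le hp.le h.1 (ENNReal.inv_ne_top.2 hκ) fun _ hf x => ?_⟩
  rw [← ENNReal.div_eq_inv_mul, ENNReal.le_div_iff_mul_le (Or.inl hκ)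
    (Or.inl ENNReal.ofReal_ne_top), mul_comm]
  exact locPart_hardyLittlewood_le h𝒩 hf x

end OscillatorWeights


open OscillatorWeights
theorem mainTheorem5 (d : ℕ) (hd : 1 ≤ d) (𝒩 : Set (E d) → Set (Set (E d)))
    (h𝒩 : IsNearSystem 𝒩) (p : ℝ) (hp : 1 < p) :
    ApPlus 𝒩 p ⊆ oscClass d p ∧
      oscClass d p ⊆ ApMinus 𝒩 p ∧
      oscClass d p ⊆ ApFarMinus 𝒩 p ∩ ApLoc 𝒩 p :=
  ⟨fun _ h => mem_oscClass_of_mem_ApPlus hd h𝒩 hp h,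
    fun _ h => ⟨mem_ApFarMinus_of_mem_oscClass hp h, mem_locClass_of_mem_oscClass h𝒩 hp h⟩,
    fun _ h => ⟨mem_ApFarMinus_of_mem_oscClass hp h, mem_ApLoc_of_mem_oscClass hd h𝒩 hp h⟩⟩
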